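/- Let $\mathbb T=\mathbb R/2\pi\mathbb Z$. An input of the vacuum near-axis problem consists of a closed curve $\mathbf r_0\in C^\infty(\mathbb T,\mathbb R^3)$ with speed $\ell'=\|\mathbf r_0'\|>0$ and curvature $\kappa>0$ (torsion $\tau$), an on-axis field $B_0\in C^\infty(\mathbb T,\mathbb R)$, and moments $\phi_{m0},\phi_{mm}\in C^\infty(\mathbb T,\mathbb C)$ for $m\ge 2$. In Frenet–Serret coordinates $\mathbf r=\mathbf r_0(s)+\rho\cos\theta\,\mathbf n(s)+\rho\sin\theta\,\mathbf b(s)$ put $h_s=\ell'(1-\kappa\rho\cos\theta)$, $\mathsf A=h_s$, $\mathsf B=h_s+\rho^2h_s^{-1}(\ell')^2\tau^2$, $\mathsf C=-h_s^{-1}\ell'\tau$, $\mathsf D=h_s^{-1}$, all expanded in powers of $\rho$. The near-axis solution is the formal series $\phi=\sum_{m\ge0}\phi_m(\theta,s)\rho^m$, $\phi_m=\sum_{n=0}^m\phi_{mn}(s)e^{(2n-m)i\theta}$ with $\phi_{mn}\in C^\infty(\mathbb T,\mathbb C)$, $\phi_{00}=\phi_{10}=\phi_{11}=0$, the given $\phi_{m0},\phi_{mm}$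 for $m\ge 2$, that solves Poisson's equation $\Delta\phi=-\nabla\cdot(B_0\ell'\nabla s)$ order by order, i.e. for all $m\ge2$, with $\phi_{<m}=\sum_{k<m}\phi_k\rho^k$, $$\ell'\,(m^2+\partial_\theta^2)\phi_m=-m(m-1)\mathsf A_1\phi_{m-1}-\big[\partial_\theta(\mathsf B\,\partial_\theta\phi_{<m})\big]_m-\big[\partial_\theta(\mathsf C(\partial_s\phi_{<m}+B_0\ell'))+\partial_s(\mathsf C\,\partial_\theta\phi_{<m})\big]_{m-2}-\big[\partial_s(\mathsf D(\partial_s\phi_{<m}+B_0\ell'))\big]_{m-2}.$$ Let $\phi^{(\mathrm{IC})}=\sum_{m\ge2}\rho^m(\phi_{m0}e^{-im\theta}+\phi_{mm}e^{im\theta})$, and for $\sigma>0$ and an integer $q\ge0$ let $\|f\|_{\sigma,H^q}=\sup_m\sigma^m\|f_m\|_{H^q(\mathbb T^2)}\in[0,\infty]$ be the $(\sigma,H^q)$-analytic norm. **Theorem.** Every input has exactly one near-axis solution. Let $q_0\ge0$ and $q\ge2$ be integers and let $\sigma_0,\sigma>0$. At every input the near-axis problem is ill-posed: the map from the input to the solution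 $\phi$ is not continuous there under perturbations of the input in $C^\infty$, with respect to the $C^{4+q_0}(\mathbb T)$ norm on $\mathbf r_0$, the $H^{1+q_0}(\mathbb T)$ norm on $B_0$, the $(\sigma_0,H^{2+q_0})$-analytic norm on $\phi^{(\mathrm{IC})}$, and the $(\sigma,H^q)$-analytic norm on $\phi$. That is, there is $\varepsilon>0$ such that arbitrarily small perturbations of the input, in these norms, change $\phi$ by at least $\varepsilon$ in the $(\sigma,H^q)$-analytic norm (possibly by $\infty$). If $B_0>0$ and the data are real ($\phi_{mm}=\overline{\phi_{m0}}$), this already holds with perturbed inputs that have the same two properties. -/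

import Mathlib

open scoped ContDiff ENNReal

noncomputable section

namespace NearAxis

/-- Euclidean three-space. -/
abbrev E3 : Type := EuclideanSpace ℝ (Fin 3)

/-- The cross product of Euclidean three-space. -/
def cross (u v : E3) : E3 := WithLp.toLp 2 (crossProduct (WithLp.ofLp u) (WithLp.ofLp v))

/-! Functions on the circle `𝕋 = ℝ / 2πℤ` are `2π`-periodic functions on `ℝ`. -/

/-- `f ∈ C^∞(𝕋)`. -/
def SmoothPeriodic {F : Type*} [NormedAddCommGroup F] [NormedSpace ℝ F] (f : ℝ → F) : Prop :=
  ContDiff ℝ ∞ f ∧ Function.Periodic f (2 * Real.pi)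

/-! ### Frenet–Serret geometry of a curve -/

/-- `ℓ' = ‖r₀'‖`. -/
def speed (r : ℝ → E3) (s : ℝ) : ℝ := ‖deriv r s‖

/-- The unit tangent `t = r₀' / ℓ'`. -/
def tangent (r : ℝ → E3) (s : ℝ) : E3 := (speed r s)⁻¹ • deriv r s

/-- The curvature `κ = ‖t'‖ / ℓ'`. -/
def curvature (r : ℝ → E3) (s : ℝ) : ℝ := ‖deriv (tangent r) s‖ / speed r s

/-- The unit normal `n = t' / (κ ℓ')`. -/
def normal (r : ℝ → E3) (s : ℝ) : E3 :=
  (curvature r s * speed r s)⁻¹ • deriv (tangent r) s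

/-- The binormal `b = t × n`. -/
def binormal (r : ℝ → E3) (s : ℝ) : E3 := cross (tangent r s) (normal r s)

/-- The torsion, fixed by the Frenet equation `n' = ℓ' (-κ t + τ b)`. -/
def torsion (r : ℝ → E3) (s : ℝ) : ℝ :=
  inner ℝ (deriv (normal r) s) (binormal r s) / speed r s

/-! ### Formal power series in `ρ`; the `m`-th coefficient is a function of `(θ, s)` -/

/-- A formal series `∑ₘ fₘ(θ, s) ρ^m`, written `f m θ s`. -/
abbrev RhoSeries : Type := ℕ → ℝ → ℝ → ℂ

/-- The product of two formal series. -/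
def mulSeries (f g : RhoSeries) : RhoSeries := fun m θ s =>
  ∑ p ∈ Finset.HasAntidiagonal.antidiagonal m, f p.1 θ s * g p.2 θ s

/-- `∂/∂θ`, coefficientwise. -/
def dTheta (f : RhoSeries) : RhoSeries := fun m θ s => deriv (fun t => f m t s) θ

/-- `∂/∂s`, coefficientwise. -/
def dS (f : RhoSeries) : RhoSeries := fun m θ s => deriv (fun u => f m θ u) s

/-- The partial sum `f_{<m} = ∑_{k<m} f_k ρ^k`. -/
def trunc (m : ℕ) (f : RhoSeries) : RhoSeries := fun k θ s => if k < m then f k θ s else 0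

/-- Multiplication by `ρ²`. -/
def rhoSq (f : RhoSeries) : RhoSeries := fun m θ s => if 2 ≤ m then f (m - 2) θ s else 0

/-- A function of `s` alone, as a series with only an order-zero term. -/
def ofAxis (c : ℝ → ℝ) : RhoSeries := fun m _ s => if m = 0 then (c s : ℂ) else 0

/-- `h_s = ℓ' (1 - κ ρ cos θ)`. -/
def hSeries (r : ℝ → E3) : RhoSeries := fun m θ s =>
  if m = 0 then (speed r s : ℂ)
  else if m = 1 then ((-(speed r s * curvature r s * Real.cos θ) : ℝ) : ℂ)
  else 0

/-- `h_s⁻¹ = (1/ℓ') ∑ₘ (κ cos θ)^m ρ^m`. -/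
def hInvSeries (r : ℝ → E3) : RhoSeries := fun m θ s =>
  (((curvature r s * Real.cos θ) ^ m / speed r s : ℝ) : ℂ)

theorem mulSeries_hSeries_hInvSeries (r : ℝ → E3) (m : ℕ) (θ s : ℝ) (h : speed r s ≠ 0) :
    mulSeries (hSeries r) (hInvSeries r) m θ s = if m = 0 then 1 else 0 := by
  have h' : (speed r s : ℂ) ≠ 0 := by exact_mod_cast h
  unfold mulSeries
  rw [Finset.Nat.sum_antidiagonal_eq_sum_range_succ_mk]
  rcases m with _ | m
  · simp [hSeries, hInvSeries, h']
  · rw [Finset.sum_range_succ', Finset.sum_range_succ', Finset.sum_eq_zero]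
    · simp only [hSeries, hInvSeries]
      push_cast
      simp
      field_simp
      ring
    · intro k _
      simp [hSeries]

/-- `𝖠 = h_s`. -/
def coeffA (r : ℝ → E3) : RhoSeries := hSeries r

/-- `𝖡 = h_s + ρ² h_s⁻¹ (ℓ')² τ²`. -/
def coeffB (r : ℝ → E3) : RhoSeries :=
  hSeries r +
    rhoSq (mulSeries (hInvSeries r) (ofAxis fun s => speed r s ^ 2 * torsion r s ^ 2))

/-- `𝖢 = -h_s⁻¹ ℓ' τ`. -/
def coeffC (r : ℝ → E3) : RhoSeries :=
  -mulSeries (hInvSeries r) (ofAxis fun s => speed r s * torsion r s)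

/-- `𝖣 = h_s⁻¹`. -/
def coeffD (r : ℝ → E3) : RhoSeries := hInvSeries r

/-! ### The vacuum near-axis problem -/

/-- Inputs of the near-axis problem: a smooth closed curve `r₀` with `ℓ' > 0` and `κ > 0`, a smooth
on-axis field `B₀`, and smooth higher moments `φ_{m0}`, `φ_{mm}` for `m ≥ 2`
(the values of `phiMinus` and `phiPlus` at `m < 2` are never used). -/
structure Input where
  /-- the axis `r₀` -/
  axis : ℝ → E3
  /-- the on-axis field `B₀` -/
  field : ℝ → ℝ
  /-- `m ↦ φ_{m0}`, the coefficient of `e^{-imθ}` -/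
  phiMinus : ℕ → ℝ → ℂ
  /-- `m ↦ φ_{mm}`, the coefficient of `e^{imθ}` -/
  phiPlus : ℕ → ℝ → ℂ
  axis_smooth : SmoothPeriodic axis
  field_smooth : SmoothPeriodic field
  phiMinus_smooth : ∀ m, 2 ≤ m → SmoothPeriodic (phiMinus m)
  phiPlus_smooth : ∀ m, 2 ≤ m → SmoothPeriodic (phiPlus m)
  speed_pos : ∀ s, 0 < speed axis s
  curvature_pos : ∀ s, 0 < curvature axis s

/-- The inputs with a positive on-axis field and real-valued `φ^{(IC)}`,
i.e. `φ_{mm}` is the complex conjugate of `φ_{m0}`. -/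
def physicalInputs : Set Input :=
  {x | (∀ s, 0 < x.field s) ∧
    ∀ m, 2 ≤ m → ∀ s, x.phiPlus m s = starRingEnd ℂ (x.phiMinus m s)}

/-- `e^{ikθ}`. -/
def expMode (k : ℤ) (θ : ℝ) : ℂ := Complex.exp (Complex.I * (k : ℂ) * (θ : ℂ))

/-- `φ^{(IC)} = ∑_{m ≥ 2} ρ^m (φ_{m0} e^{-imθ} + φ_{mm} e^{imθ})`;
the terms with `m < 2` vanish because `φ₀₀ = φ₁₀ = φ₁₁ = 0`. -/
def Input.phiIC (x : Input) : RhoSeries := fun m θ s =>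
  if 2 ≤ m then
    x.phiMinus m s * expMode (-(m : ℤ)) θ + x.phiPlus m s * expMode (m : ℤ) θ
  else 0

/-- The order-`m` equation (for `m ≥ 2`) of the expansion in `ρ` of Poisson's equation
`Δφ = -∇·(B₀ ℓ' ∇s)`, multiplied by `h_s`, in Frenet–Serret coordinates `(ρ, θ, s)`. -/
def OrderEquation (x : Input) (φ : RhoSeries) (m : ℕ) : Prop :=
  ∀ θ s : ℝ,
    (speed x.axis s : ℂ) * ((m : ℂ) ^ 2 * φ m θ s + dTheta (dTheta φ) m θ s) =
      - ((m : ℂ) * ((m : ℂ) - 1) * coeffA x.axis 1 θ s * φ (m - 1) θ s)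
      - dTheta (mulSeries (coeffB x.axis) (dTheta (trunc m φ))) m θ s
      - (dTheta (mulSeries (coeffC x.axis)
            (dS (trunc m φ) + ofAxis fun u => x.field u * speed x.axis u)) (m - 2) θ s
          + dS (mulSeries (coeffC x.axis) (dTheta (trunc m φ))) (m - 2) θ s)
      - dS (mulSeries (coeffD x.axis)
            (dS (trunc m φ) + ofAxis fun u => x.field u * speed x.axis u)) (m - 2) θ s

/-- `φ` is a formal solution of the near-axis problem with input `x`:
`φₘ = ∑_{n ≤ m} φ_{mn}(s) e^{(2n-m)iθ}` with smooth `φ_{mn}`, the data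
`φ₀₀ = φ₁₀ = φ₁₁ = 0` and `φ_{m0}`, `φ_{mm}` (`m ≥ 2`) are attained, and the equation holds at
every order `m ≥ 2`. -/
def IsSolution (x : Input) (φ : RhoSeries) : Prop :=
  (∃ a : ℕ → ℕ → ℝ → ℂ,
    (∀ m n, SmoothPeriodic (a m n)) ∧
    (∀ m θ s, φ m θ s =
      ∑ n ∈ Finset.range (m + 1), a m n s * expMode (2 * (n : ℤ) - (m : ℤ)) θ) ∧
    a 0 0 = 0 ∧ a 1 0 = 0 ∧ a 1 1 = 0 ∧
    ∀ m, 2 ≤ m → a m 0 = x.phiMinus m ∧ a m m = x.phiPlus m) ∧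
  ∀ m, 2 ≤ m → OrderEquation x φ m

/-! ### Norms (with values in `[0, ∞]`) -/

/-- The `C^k(𝕋)` norm `∑_{i ≤ k} sup ‖f^{(i)}‖`. -/
def cNorm {F : Type*} [NormedAddCommGroup F] [NormedSpace ℝ F] (k : ℕ) (f : ℝ → F) : ℝ≥0∞ :=
  ∑ i ∈ Finset.range (k + 1), ⨆ s : ℝ, ‖iteratedDeriv i f s‖ₑ

/-- The `H^k(𝕋)` norm of a smooth periodic function. -/
def sobolevNorm (k : ℕ) (f : ℝ → ℝ) : ℝ≥0∞ :=
  (∑ i ∈ Finset.range (k + 1),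
    ∫⁻ s in Set.Ioc 0 (2 * Real.pi), ‖iteratedDeriv i f s‖ₑ ^ 2) ^ (1 / 2 : ℝ)

/-- `∂^{a+b} f / ∂θ^a ∂s^b`. -/
def mixedDeriv (a b : ℕ) (f : ℝ → ℝ → ℂ) (θ s : ℝ) : ℂ :=
  iteratedDeriv a (fun t => iteratedDeriv b (fun u => f t u) s) θ

/-- The `H^q(𝕋²)` norm of a smooth doubly periodic function: the square root of the sum, over the
multi-indices `(a, b)` with `a + b ≤ q`, of `‖∂_θ^a ∂_s^b f‖²_{L²(𝕋²)}`. -/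
def sobolevNorm₂ (q : ℕ) (f : ℝ → ℝ → ℂ) : ℝ≥0∞ :=
  (∑ k ∈ Finset.range (q + 1), ∑ α ∈ Finset.HasAntidiagonal.antidiagonal k,
    ∫⁻ θ in Set.Ioc 0 (2 * Real.pi), ∫⁻ s in Set.Ioc 0 (2 * Real.pi),
      ‖mixedDeriv α.1 α.2 f θ s‖ₑ ^ 2) ^ (1 / 2 : ℝ)

/-- The `(σ, H^q)`-analytic norm `sup_m σ^m ‖f_m‖_{H^q}`. -/
def analyticNorm (σ : ℝ) (q : ℕ) (f : RhoSeries) : ℝ≥0∞ :=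
  ⨆ m : ℕ, ENNReal.ofReal (σ ^ m) * sobolevNorm₂ q (f m)

/-- Continuity at the input `x`, among inputs of the class `𝒳`, of the map sending an input to its
near-axis solution, for the `C^{4+q₀}` norm on the axis, the `H^{1+q₀}` norm on the on-axis field,
the `(σ₀, H^{2+q₀})`-analytic norm on `φ^{(IC)}`, and the `(σ, H^q)`-analytic norm on the solution. -/
def SolutionContinuousAt (𝒳 : Set Input) (q₀ q : ℕ) (σ₀ σ : ℝ) (x : Input) : Prop :=
  ∀ ε : ℝ≥0∞, 0 < ε → ∃ δ : ℝ≥0∞, 0 < δ ∧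
    ∀ x' ∈ 𝒳,
      cNorm (4 + q₀) (x'.axis - x.axis) < δ →
      sobolevNorm (1 + q₀) (x'.field - x.field) < δ →
      analyticNorm σ₀ (2 + q₀) (x'.phiIC - x.phiIC) < δ →
      ∀ φ φ' : RhoSeries, IsSolution x φ → IsSolution x' φ' →
        analyticNorm σ q (φ' - φ) < ε

end NearAxis

end

/-! The operator `m² + ∂_θ²` acts only in `θ`, and its kernel among the modes of order `m` is
spanned by `e^{±imθ}`, which are prescribed. On the right-hand side these top modes cancel
(`Trig.coeffA_cancel`), so each order is solved uniquely by dividing Fourier modes by nonzero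
numbers. This gives existence and uniqueness.

The same division gains no regularity in `s`, while the term `∂_s(𝖣₀ ∂_s φ_{m-2})` costs two
`s`-derivatives for every two orders. It is a Cauchy problem for an elliptic equation, unstable as
in Hadamard's example. Perturb only `φ₂₀` and `φ₂₂`, by `N^{-M} e^{±iNs}` with `M = q₀ + 3`. The `2
+ q₀` derivatives measured on the data leave a perturbation of size `O(1/N)`. At order `2j + 2` the
solution responds by `N^{2j-M}` times a positive amplitude times `2 cos(Ns - 2θ)`, plus lower powers
of `N`. For `j = q₀ + 2` the exponent is `q₀ + 1`, so one coefficient already diverges in `L²`,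
whatever `σ` and `q` are.

Powers of `N` are counted by a `Filtration`: the coefficient of order `q` has degree `q - 1`, and
`trig_rhs_add` isolates the only term that raises the degree too far. `trig_response_sub_lead`
extracts the leading part, and `exists_response_lower_bound` turns it into growth. With the trivial
filtration, the same calculus gives existence. -/

noncomputable section

namespace NearAxis

/-! ### Calculus of smooth periodic functions. -/

section SmoothPeriodic

variable {F G : Type*} [NormedAddCommGroup F] [NormedSpace ℝ F]
  [NormedAddCommGroup G] [NormedSpace ℝ G]

theorem SmoothPeriodic.differentiable {f : ℝ → F} (hf : SmoothPeriodic f) :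
    Differentiable ℝ f :=
  hf.1.differentiable (by simp)

theorem SmoothPeriodic.deriv {f : ℝ → F} (hf : SmoothPeriodic f) :
    SmoothPeriodic (deriv f) := by
  refine ⟨(contDiff_infty_iff_deriv.1 hf.1).2, fun s => ?_⟩
  have h : (fun t => f (t + 2 * Real.pi)) = f := funext hf.2
  rw [← deriv_comp_add_const, h]

theorem smoothPeriodic_const (c : F) : SmoothPeriodic fun _ => c :=
  ⟨contDiff_const, fun _ => rfl⟩

theorem smoothPeriodic_zero : SmoothPeriodic (0 : ℝ → F) := smoothPeriodic_const 0

theorem SmoothPeriodic.comp {f : ℝ → F} {g : F → G} (hf : SmoothPeriodic f)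
    (hg : ContDiff ℝ ∞ g) : SmoothPeriodic fun s => g (f s) :=
  ⟨hg.comp hf.1, fun s => by simp only [hf.2 s]⟩

theorem SmoothPeriodic.add {f g : ℝ → F} (hf : SmoothPeriodic f) (hg : SmoothPeriodic g) :
    SmoothPeriodic fun s => f s + g s :=
  ⟨hf.1.add hg.1, fun s => by simp only [hf.2 s, hg.2 s]⟩

theorem SmoothPeriodic.smul {f : ℝ → ℝ} {g : ℝ → F} (hf : SmoothPeriodic f)
    (hg : SmoothPeriodic g) : SmoothPeriodic fun s => f s • g s :=
  ⟨hf.1.smul hg.1, fun s => by simp only [hf.2 s, hg.2 s]⟩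

theorem SmoothPeriodic.mul {A : Type*} [NormedRing A] [NormedAlgebra ℝ A] {f g : ℝ → A}
    (hf : SmoothPeriodic f) (hg : SmoothPeriodic g) : SmoothPeriodic fun s => f s * g s :=
  ⟨hf.1.mul hg.1, fun s => by simp only [hf.2 s, hg.2 s]⟩

theorem SmoothPeriodic.pow {A : Type*} [NormedRing A] [NormedAlgebra ℝ A] {f : ℝ → A}
    (hf : SmoothPeriodic f) (n : ℕ) : SmoothPeriodic fun s => f s ^ n :=
  ⟨hf.1.pow n, fun s => by simp only [hf.2 s]⟩

theorem SmoothPeriodic.inv {f : ℝ → ℝ} (hf : SmoothPeriodic f) (h : ∀ s, f s ≠ 0) :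
    SmoothPeriodic fun s => (f s)⁻¹ :=
  ⟨hf.1.inv h, fun s => by simp only [hf.2 s]⟩

theorem SmoothPeriodic.div {f g : ℝ → ℝ} (hf : SmoothPeriodic f) (hg : SmoothPeriodic g)
    (h : ∀ s, g s ≠ 0) : SmoothPeriodic fun s => f s / g s :=
  ⟨hf.1.div hg.1 h, fun s => by simp only [hf.2 s, hg.2 s]⟩

theorem SmoothPeriodic.norm {f : ℝ → E3} (hf : SmoothPeriodic f) (h : ∀ s, f s ≠ 0) :
    SmoothPeriodic fun s => ‖f s‖ :=
  ⟨hf.1.norm ℝ h, fun s => by simp only [hf.2 s]⟩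

theorem SmoothPeriodic.inner {f g : ℝ → E3} (hf : SmoothPeriodic f) (hg : SmoothPeriodic g) :
    SmoothPeriodic fun s => inner ℝ (f s) (g s) :=
  ⟨hf.1.inner ℝ hg.1, fun s => by simp only [hf.2 s, hg.2 s]⟩

theorem SmoothPeriodic.cross {f g : ℝ → E3} (hf : SmoothPeriodic f) (hg : SmoothPeriodic g) :
    SmoothPeriodic fun s => cross (f s) (g s) := by
  refine ⟨?_, fun s => by simp only [hf.2 s, hg.2 s]⟩
  have hf' := contDiff_euclidean.1 hf.1
  have hg' := contDiff_euclidean.1 hg.1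
  rw [contDiff_euclidean]
  intro i
  fin_cases i <;> simp only [NearAxis.cross, cross_apply] <;>
    exact ((hf' _).mul (hg' _)).sub ((hf' _).mul (hg' _))

theorem SmoothPeriodic.ofReal {f : ℝ → ℝ} (hf : SmoothPeriodic f) :
    SmoothPeriodic fun s => (f s : ℂ) :=
  hf.comp Complex.ofRealCLM.contDiff

end SmoothPeriodic

/-! ### Smoothness of the Frenet data. -/

section Frenet

variable (x : Input)

theorem Input.smoothPeriodic_speed : SmoothPeriodic (speed x.axis) :=
  x.axis_smooth.deriv.norm fun s h => (x.speed_pos s).ne' (by simp [speed, h])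

theorem Input.smoothPeriodic_tangent : SmoothPeriodic (tangent x.axis) :=
  (x.smoothPeriodic_speed.inv fun s => (x.speed_pos s).ne').smul x.axis_smooth.deriv

theorem Input.smoothPeriodic_curvature : SmoothPeriodic (curvature x.axis) :=
  (x.smoothPeriodic_tangent.deriv.norm
    fun s h => (x.curvature_pos s).ne' (by simp [curvature, h])).div
      x.smoothPeriodic_speed fun s => (x.speed_pos s).ne'

theorem Input.smoothPeriodic_normal : SmoothPeriodic (normal x.axis) :=
  ((x.smoothPeriodic_curvature.mul x.smoothPeriodic_speed).inv fun s =>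
    (mul_pos (x.curvature_pos s) (x.speed_pos s)).ne').smul x.smoothPeriodic_tangent.deriv

theorem Input.smoothPeriodic_torsion : SmoothPeriodic (torsion x.axis) :=
  (x.smoothPeriodic_normal.deriv.inner
    (x.smoothPeriodic_tangent.cross x.smoothPeriodic_normal)).div
      x.smoothPeriodic_speed fun s => (x.speed_pos s).ne'

end Frenet

/-! ### Fourier modes in the angle. -/

section ExpMode

theorem expMode_zero (θ : ℝ) : expMode 0 θ = 1 := by simp [expMode]

theorem expMode_add (j k : ℤ) (θ : ℝ) : expMode (j + k) θ = expMode j θ * expMode k θ := by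
  simp only [expMode, ← Complex.exp_add]
  congr 1
  push_cast
  ring

theorem expMode_map_add (k : ℤ) (θ t : ℝ) : expMode k (θ + t) = expMode k θ * expMode k t := by
  simp only [expMode, ← Complex.exp_add]
  congr 1
  push_cast
  ring

theorem norm_expMode (k : ℤ) (θ : ℝ) : ‖expMode k θ‖ = 1 := by
  rw [expMode, show Complex.I * (k : ℂ) * (θ : ℂ) = ((k * θ : ℝ) : ℂ) * Complex.I by
    push_cast; ring, Complex.norm_exp_ofReal_mul_I]

theorem conj_expMode (k : ℤ) (θ : ℝ) : starRingEnd ℂ (expMode k θ) = expMode (-k) θ := by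
  simp [expMode, ← Complex.exp_conj]

theorem hasDerivAt_expMode (k : ℤ) (θ : ℝ) :
    HasDerivAt (expMode k) (Complex.I * k * expMode k θ) θ := by
  have h := ((hasDerivAt_id θ).ofReal_comp.const_mul (Complex.I * (k : ℂ))).cexp
  exact HasDerivAt.congr_deriv (f := expMode k) h (by simp [expMode, mul_comm])

theorem deriv_expMode (k : ℤ) : deriv (expMode k) = fun θ => Complex.I * k * expMode k θ :=
  funext fun θ => (hasDerivAt_expMode k θ).deriv

theorem smoothPeriodic_expMode (k : ℤ) : SmoothPeriodic (expMode k) := by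
  refine ⟨?_, fun θ => ?_⟩
  · exact (contDiff_const.mul Complex.ofRealCLM.contDiff).cexp
  · simp only [expMode]
    rw [Complex.exp_eq_exp_iff_exists_int]
    exact ⟨k, by push_cast; ring⟩

theorem cos_mul_expMode (k : ℤ) (θ : ℝ) :
    (Real.cos θ : ℂ) * expMode k θ = (expMode (k + 1) θ + expMode (k - 1) θ) / 2 := by
  rw [sub_eq_add_neg, expMode_add, expMode_add, Complex.ofReal_cos, Complex.cos]
  have h1 : expMode 1 θ = Complex.exp (θ * Complex.I) := by simp [expMode, mul_comm]
  have h2 : expMode (-1) θ = Complex.exp (-θ * Complex.I) := by simp [expMode, mul_comm]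
  rw [h1, h2]
  ring

/-- Distinct characters of the additive group `ℝ` are independent (Dedekind); the derivative at `0`
tells them apart. -/
theorem linearIndependent_expMode : LinearIndependent ℂ fun k : ℤ => expMode k := by
  let χ : ℤ → (Multiplicative ℝ →* ℂ) := fun k =>
    { toFun := fun t => expMode k t.toAdd
      map_one' := by simp [expMode]
      map_mul' := fun a b => by simp [expMode_map_add] }
  have hχ : Function.Injective χ := by
    intro j k h
    have h1 : (fun θ => expMode j θ) = fun θ => expMode k θ :=
      funext fun θ => DFunLike.congr_fun h (Multiplicative.ofAdd θ)
    have h2 : deriv (expMode j) 0 = deriv (expMode k) 0 := by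
      rw [show expMode j = expMode k from h1]
    rw [deriv_expMode, deriv_expMode] at h2
    simpa [expMode] using h2
  exact (linearIndependent_monoidHom (Multiplicative ℝ) ℂ).comp χ hχ

end ExpMode

/-! ### Graded trigonometric polynomials and inversion of the angular operator. -/

section

/-- An increasing filtration of families, indexed by `ι`, of smooth periodic functions: a module
over the smooth periodic functions on which differentiation raises the degree by at most one,
except in degree zero. -/
structure Filtration (ι : Type*) where
  /-- the families of degree at most `d` -/
  mem : ℕ → (ι → ℝ → ℂ) → Prop
  smooth : ∀ {d c}, mem d c → ∀ i, SmoothPeriodic (c i)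
  mono : ∀ {d e c}, d ≤ e → mem d c → mem e c
  const : ∀ {d p}, SmoothPeriodic p → mem d fun _ => p
  add : ∀ {d c c'}, mem d c → mem d c' → mem d fun i s => c i s + c' i s
  smul : ∀ {d c p}, SmoothPeriodic p → mem d c → mem d fun i s => p s * c i s
  deriv : ∀ {d c}, mem d c → mem (d + 1) fun i => deriv (c i)
  deriv_zero : ∀ {c}, mem 0 c → mem 0 fun i => _root_.deriv (c i)

/-- Families of trigonometric polynomials in `θ` of degree at most `m` and of the parity of `m`,
with coefficients of degree at most `d` in `V`. -/
inductive Trig {ι : Type*} (V : Filtration ι) (m d : ℕ) : (ι → ℝ → ℝ → ℂ) → Prop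
  | mode (n : ℕ) (c : ι → ℝ → ℂ) : n ≤ m → V.mem d c →
      Trig V m d fun i θ s => c i s * expMode (2 * n - m) θ
  | add (f g : ι → ℝ → ℝ → ℂ) : Trig V m d f → Trig V m d g →
      Trig V m d fun i θ s => f i θ s + g i θ s

variable {ι : Type*} {V : Filtration ι} {m d e : ℕ} {f g : ι → ℝ → ℝ → ℂ}

theorem Trig.congr (hf : Trig V m d f) (h : ∀ i θ s, g i θ s = f i θ s) : Trig V m d g := by
  have : g = f := by
    funext i θ s
    exact h i θ s
  rwa [this]

theorem Trig.zero : Trig V m d fun _ _ _ => 0 :=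
  (Trig.mode 0 _ (Nat.zero_le m) (V.const smoothPeriodic_zero)).congr (by simp)

theorem Trig.mono (hde : d ≤ e) (hf : Trig V m d f) : Trig V m e f := by
  induction hf with
  | mode n c hn hc => exact .mode n c hn (V.mono hde hc)
  | add f g _ _ hf hg => exact .add _ _ hf hg

theorem Trig.smul {p : ℝ → ℂ} (hp : SmoothPeriodic p) (hf : Trig V m d f) :
    Trig V m d fun i θ s => p s * f i θ s := by
  induction hf with
  | mode n c hn hc =>
    exact (Trig.mode n _ hn (V.smul hp hc)).congr fun i θ s => by ring
  | add f g _ _ hf hg => exact (hf.add _ _ hg).congr fun i θ s => by ring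

theorem Trig.const_mul (a : ℂ) (hf : Trig V m d f) : Trig V m d fun i θ s => a * f i θ s :=
  hf.smul (smoothPeriodic_const a)

theorem Trig.neg (hf : Trig V m d f) : Trig V m d fun i θ s => -f i θ s :=
  (hf.const_mul (-1)).congr fun i θ s => by ring

theorem Trig.sub (hf : Trig V m d f) (hg : Trig V m d g) :
    Trig V m d fun i θ s => f i θ s - g i θ s :=
  (hf.add _ _ hg.neg).congr fun i θ s => by ring

theorem Trig.sum {α : Type*} (S : Finset α) {f : α → ι → ℝ → ℝ → ℂ}
    (hf : ∀ a ∈ S, Trig V m d (f a)) : Trig V m d fun i θ s => ∑ a ∈ S, f a i θ s := by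
  classical
  induction S using Finset.induction_on with
  | empty => exact Trig.zero.congr (by simp)
  | insert a S ha ih =>
    exact ((hf a (by simp)).add _ _ (ih fun b hb => hf b (by simp [hb]))).congr
      fun i θ s => by rw [Finset.sum_insert ha]

theorem Trig.cos_mul (hf : Trig V m d f) :
    Trig V (m + 1) d fun i θ s => (Real.cos θ : ℂ) * f i θ s := by
  induction hf with
  | mode n c hn hc =>
    have h := V.smul (smoothPeriodic_const (1 / 2 : ℂ)) hc
    refine ((Trig.mode (m := m + 1) (n + 1) _ (by omega) h).add _ _
      (Trig.mode n _ (by omega) h)).congr fun i θ s => ?_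
    rw [mul_left_comm, cos_mul_expMode,
      show (2 * ((n + 1 : ℕ) : ℤ) - ((m + 1 : ℕ) : ℤ)) = 2 * n - m + 1 by push_cast; ring,
      show (2 * (n : ℤ) - ((m + 1 : ℕ) : ℤ)) = 2 * n - m - 1 by push_cast; ring]
    ring
  | add f g _ _ hf hg => exact (hf.add _ _ hg).congr fun i θ s => by ring

theorem Trig.cos_pow_mul (hf : Trig V m d f) (k : ℕ) :
    Trig V (k + m) d fun i θ s => (Real.cos θ : ℂ) ^ k * f i θ s := by
  induction k with
  | zero => simpa using hf
  | succ k ih =>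
    rw [add_right_comm]
    exact ih.cos_mul.congr fun i θ s => by ring

theorem Trig.of_axis {p : ℝ → ℂ} (hp : SmoothPeriodic p) : Trig V 0 d fun _ _ s => p s :=
  (Trig.mode 0 _ le_rfl (V.const hp)).congr (by simp [expMode_zero])

/-- The shift `n ↦ n + 1` keeps the frequency `2n - m`. It places the solved part of order `m + 2`,
whose modes stop at `m`, among the modes of that order. -/
theorem Trig.raise (hf : Trig V m d f) : Trig V (m + 2) d f := by
  induction hf with
  | mode n c hn hc =>
    refine (Trig.mode (m := m + 2) (n + 1) _ (by omega) hc).congr fun i θ s => ?_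
    rw [show (2 * ((n + 1 : ℕ) : ℤ) - ((m + 2 : ℕ) : ℤ)) = 2 * n - m by push_cast; ring]
  | add f g _ _ hf hg => exact hf.add _ _ hg

theorem Trig.contDiff_theta (hf : Trig V m d f) (i : ι) (s : ℝ) :
    ContDiff ℝ ∞ fun θ => f i θ s := by
  induction hf with
  | mode n c hn hc => exact contDiff_const.mul (smoothPeriodic_expMode _).1
  | add f g _ _ hf hg => exact hf.add hg

theorem Trig.contDiff_s (hf : Trig V m d f) (i : ι) (θ : ℝ) :
    ContDiff ℝ ∞ fun s => f i θ s := by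
  induction hf with
  | mode n c hn hc => exact (V.smooth hc i).1.mul contDiff_const
  | add f g _ _ hf hg => exact hf.add hg

theorem Trig.differentiable_theta (hf : Trig V m d f) (i : ι) (s : ℝ) :
    Differentiable ℝ fun θ => f i θ s :=
  (hf.contDiff_theta i s).differentiable (by simp)

theorem Trig.differentiable_s (hf : Trig V m d f) (i : ι) (θ : ℝ) :
    Differentiable ℝ fun s => f i θ s :=
  (hf.contDiff_s i θ).differentiable (by simp)

theorem deriv_mul_expMode (a : ℂ) (k : ℤ) (θ : ℝ) :
    deriv (fun t => a * expMode k t) θ = Complex.I * k * a * expMode k θ := by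
  rw [((hasDerivAt_expMode k θ).const_mul a).deriv]
  ring

theorem Trig.deriv_theta (hf : Trig V m d f) :
    Trig V m d fun i θ s => deriv (fun t => f i t s) θ := by
  induction hf with
  | mode n c hn hc =>
    refine (Trig.mode n _ hn (V.smul (smoothPeriodic_const
      (Complex.I * ((2 * n - m : ℤ) : ℂ))) hc)).congr fun i θ s => ?_
    rw [deriv_mul_expMode]
  | add f g hf' hg' hf hg =>
    exact (hf.add _ _ hg).congr fun i θ s =>
      deriv_fun_add (hf'.differentiable_theta i s θ) (hg'.differentiable_theta i s θ)

theorem Trig.deriv_s (hf : Trig V m d f) :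
    Trig V m (d + 1) fun i θ s => deriv (fun u => f i θ u) s := by
  induction hf with
  | mode n c hn hc =>
    exact (Trig.mode n _ hn (V.deriv hc)).congr fun i θ s =>
      deriv_mul_const ((V.smooth hc i).differentiable s) _
  | add f g hf' hg' hf hg =>
    exact (hf.add _ _ hg).congr fun i θ s =>
      deriv_fun_add (hf'.differentiable_s i θ s) (hg'.differentiable_s i θ s)

theorem Trig.deriv_s_zero (hf : Trig V m 0 f) :
    Trig V m 0 fun i θ s => deriv (fun u => f i θ u) s := by
  induction hf with
  | mode n c hn hc =>
    exact (Trig.mode n _ hn (V.deriv_zero hc)).congr fun i θ s =>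
      deriv_mul_const ((V.smooth hc i).differentiable s) _
  | add f g hf' hg' hf hg =>
    exact (hf.add _ _ hg).congr fun i θ s =>
      deriv_fun_add (hf'.differentiable_s i θ s) (hg'.differentiable_s i θ s)

/-- Degrees `d - 1` become `d` under differentiation, also for `d = 0`. -/
theorem Trig.deriv_s_pred (hf : Trig V m (d - 1) f) :
    Trig V m d fun i θ s => deriv (fun u => f i θ u) s := by
  rcases d with _ | d
  · exact hf.deriv_s_zero
  · exact hf.deriv_s

theorem Trig.exists_coeff (hf : Trig V m d f) :
    ∃ a : ℕ → ι → ℝ → ℂ, (∀ n, V.mem d (a n)) ∧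
      ∀ i θ s, f i θ s = ∑ n ∈ Finset.range (m + 1), a n i s * expMode (2 * n - m) θ := by
  induction hf with
  | mode n c hn hc =>
    refine ⟨fun k => if k = n then c else fun _ => 0, fun k => ?_, fun i θ s => ?_⟩
    · by_cases h : k = n
      · simpa [h] using hc
      · simpa [h] using V.const smoothPeriodic_zero
    · rw [Finset.sum_eq_single_of_mem n (Finset.mem_range.2 (by omega))]
      · simp
      · intro k _ hk
        simp [hk]
  | add f g _ _ hf hg =>
    obtain ⟨a, ha, hfa⟩ := hf
    obtain ⟨b, hb, hgb⟩ := hg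
    refine ⟨fun n i s => a n i s + b n i s, fun n => V.add (ha n) (hb n), fun i θ s => ?_⟩
    beta_reduce
    rw [hfa, hgb, ← Finset.sum_add_distrib]
    exact Finset.sum_congr rfl fun n _ => by ring

/-- `(k + 2)² + ∂_θ²`. -/
def angular (k : ℕ) (f : ℝ → ℂ) (θ : ℝ) : ℂ :=
  ((k + 2 : ℕ) : ℂ) ^ 2 * f θ + deriv (deriv f) θ

theorem angular_mode (k : ℕ) (a : ℂ) (j : ℤ) (θ : ℝ) :
    angular k (fun t => a * expMode j t) θ =
      (((k + 2 : ℕ) : ℂ) ^ 2 - (j : ℂ) ^ 2) * (a * expMode j θ) := by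
  have h : deriv (fun t => a * expMode j t) = fun t => Complex.I * j * a * expMode j t :=
    funext fun t => deriv_mul_expMode a j t
  rw [angular, h, deriv_mul_expMode]
  linear_combination ((j : ℂ) ^ 2 * a * expMode j θ) * Complex.I_sq

theorem angular_add (k : ℕ) {f g : ℝ → ℂ} (hf : ContDiff ℝ ∞ f) (hg : ContDiff ℝ ∞ g) (θ : ℝ) :
    angular k (fun t => f t + g t) θ = angular k f θ + angular k g θ := by
  have hf1 := hf.differentiable (by simp)
  have hg1 := hg.differentiable (by simp)
  have h : deriv (fun t => f t + g t) = fun t => deriv f t + deriv g t :=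
    funext fun t => deriv_fun_add (hf1 t) (hg1 t)
  have hf2 := ((contDiff_infty_iff_deriv.1 hf).2).differentiable (by simp)
  have hg2 := ((contDiff_infty_iff_deriv.1 hg).2).differentiable (by simp)
  rw [angular, h, deriv_fun_add (hf2 θ) (hg2 θ), angular, angular]
  ring

/-- The symbol factors as `4 (n + 1) (k - n + 1)`: the resonant frequencies `±(k + 2)` lie just
outside the range. -/
theorem angular_symbol_ne_zero {k n : ℕ} (hn : n ≤ k) :
    ((k + 2 : ℕ) : ℂ) ^ 2 - ((2 * n - k : ℤ) : ℂ) ^ 2 ≠ 0 := by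
  have h : ((k + 2 : ℕ) : ℂ) ^ 2 - ((2 * n - k : ℤ) : ℂ) ^ 2 =
      ((4 * (n + 1) * (k - n + 1) : ℕ) : ℂ) := by
    push_cast [Nat.cast_sub hn]
    ring
  rw [h, Nat.cast_ne_zero]
  positivity

/-- Each mode is divided by a constant, so the degree `d` is kept: nothing is lost, and no smoothing
in `s` is gained. -/
theorem Trig.exists_angular_eq (hf : Trig V m d f) :
    ∃ g, Trig V m d g ∧ ∀ i θ s, angular m (fun t => g i t s) θ = f i θ s := by
  induction hf with
  | mode n c hn hc =>
    refine ⟨_, Trig.mode n _ hn (V.smul (smoothPeriodic_const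
      (((m + 2 : ℕ) : ℂ) ^ 2 - ((2 * n - m : ℤ) : ℂ) ^ 2)⁻¹) hc), fun i θ s => ?_⟩
    rw [angular_mode]
    rw [mul_assoc (_)⁻¹, mul_inv_cancel_left₀ (angular_symbol_ne_zero hn)]
  | add f f' _ _ hf hf' =>
    obtain ⟨g, hg, hfg⟩ := hf
    obtain ⟨g', hg', hfg'⟩ := hf'
    refine ⟨_, hg.add _ _ hg', fun i θ s => ?_⟩
    rw [angular_add m (hg.contDiff_theta i s) (hg'.contDiff_theta i s), hfg, hfg']

theorem angular_sum (k : ℕ) {α : Type*} (S : Finset α) {f : α → ℝ → ℂ}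
    (hf : ∀ a, ContDiff ℝ ∞ (f a)) (θ : ℝ) :
    angular k (fun t => ∑ a ∈ S, f a t) θ = ∑ a ∈ S, angular k (f a) θ := by
  classical
  induction S using Finset.induction_on with
  | empty => simp [angular]
  | insert a S ha ih =>
    simp only [Finset.sum_insert ha]
    rw [angular_add k (hf a) (ContDiff.sum fun b _ => hf b), ih]

theorem sum_expMode_eq_zero {a : ℕ → ℂ} (S : Finset ℕ) (k : ℤ)
    (h : ∀ θ, ∑ n ∈ S, a n * expMode (2 * n - k) θ = 0) : ∀ n ∈ S, a n = 0 := by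
  have hli := linearIndependent_expMode.comp (fun n : ℕ => (2 * n - k : ℤ))
    fun n n' hnn => by simpa using hnn
  refine linearIndependent_iff'.1 hli S a (funext fun θ => ?_)
  simpa using h θ

theorem Trig.eq_zero_of_angular (hf : Trig V m d f) (i : ι) (s : ℝ)
    (h : ∀ θ, angular m (fun t => f i t s) θ = 0) (θ : ℝ) : f i θ s = 0 := by
  obtain ⟨a, -, ha⟩ := hf.exists_coeff
  have key : ∀ θ, ∑ n ∈ Finset.range (m + 1),
      ((((m + 2 : ℕ) : ℂ) ^ 2 - ((2 * n - m : ℤ) : ℂ) ^ 2) * a n i s) *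
        expMode (2 * n - m) θ = 0 := by
    intro θ
    rw [← h θ, show (fun t => f i t s) = fun t => ∑ n ∈ Finset.range (m + 1),
      a n i s * expMode (2 * n - m) t from funext fun t => ha i t s,
      angular_sum m _ fun n => contDiff_const.mul (smoothPeriodic_expMode _).1]
    exact Finset.sum_congr rfl fun n _ => by rw [angular_mode]; ring
  rw [ha]
  refine Finset.sum_eq_zero fun n hn => ?_
  have := sum_expMode_eq_zero _ _ key n hn
  rw [mul_eq_zero, or_iff_right (angular_symbol_ne_zero
    (Nat.lt_succ_iff.1 (Finset.mem_range.1 hn)))] at this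
  rw [this, zero_mul]

/-- The degrees `d` and `e` may differ, because injectivity depends only on the range of modes. -/
theorem Trig.eq_of_angular_eq (hf : Trig V m d f) (hg : Trig V m e g) (i : ι) (s : ℝ)
    (h : ∀ θ, angular m (fun t => f i t s) θ = angular m (fun t => g i t s) θ) (θ : ℝ) :
    f i θ s = g i θ s := by
  have hf' := hf.mono (le_max_left d e)
  have hg' := hg.mono (le_max_right d e)
  have hfg := hf'.sub hg'
  refine sub_eq_zero.1 (hfg.eq_zero_of_angular i s (fun θ => ?_) θ)
  have := angular_add m (hfg.contDiff_theta i s) (hg'.contDiff_theta i s) θ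
  simp only [sub_add_cancel] at this
  rw [h θ] at this
  simpa using this

end

/-! ### Structure and degree of the right-hand side. -/

section

variable {ι : Type*} {V : Filtration ι} {m d e : ℕ} {f g : ι → ℝ → ℝ → ℂ}

/-- Series whose coefficient of order `p` is a smooth function of `s` times `cos^p θ`. -/
def IsCosSeries (C : RhoSeries) : Prop :=
  ∃ c : ℕ → ℝ → ℂ, (∀ p, SmoothPeriodic (c p)) ∧
    ∀ p θ s, C p θ s = c p s * (Real.cos θ : ℂ) ^ p

theorem IsCosSeries.trig_mul {C : RhoSeries} (hC : IsCosSeries C) (p : ℕ) (hf : Trig V m d f) :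
    Trig V (p + m) d fun i θ s => C p θ s * f i θ s := by
  obtain ⟨c, hc, h⟩ := hC
  exact ((hf.cos_pow_mul p).smul (hc p)).congr fun i θ s => by rw [h, mul_assoc]

theorem IsCosSeries.trig_mulSeries {C : RhoSeries} (hC : IsCosSeries C) {k : ℕ}
    {Ψ : ι → RhoSeries} (hΨ : ∀ q ≤ k, Trig V q d fun i => Ψ i q) :
    Trig V k d fun i => mulSeries C (Ψ i) k := by
  refine Trig.sum _ (f := fun (p : ℕ × ℕ) i θ s => C p.1 θ s * Ψ i p.2 θ s) fun p hp => ?_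
  rw [← Finset.HasAntidiagonal.mem_antidiagonal.1 hp]
  refine hC.trig_mul p.1 (hΨ p.2 ?_)
  rw [← Finset.HasAntidiagonal.mem_antidiagonal.1 hp]
  omega

theorem mulSeries_ofAxis (f : RhoSeries) (c : ℝ → ℝ) (m : ℕ) (θ s : ℝ) :
    mulSeries f (ofAxis c) m θ s = f m θ s * c s := by
  unfold mulSeries
  rw [Finset.sum_eq_single_of_mem (m, 0) (by simp)]
  · simp [ofAxis]
  · rintro ⟨p, q⟩ hp hne
    have hq : q ≠ 0 := by
      rintro rfl
      simp_all
    simp [ofAxis, hq]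

theorem mulSeries_add_ofAxis (f g : RhoSeries) (c : ℝ → ℝ) (m : ℕ) (θ s : ℝ) :
    mulSeries f (g + ofAxis c) m θ s = mulSeries f g m θ s + f m θ s * c s := by
  rw [← mulSeries_ofAxis]
  simp only [mulSeries, ← Finset.sum_add_distrib]
  exact Finset.sum_congr rfl fun p _ => by simp [mul_add]

theorem mulSeries_congr (C : RhoSeries) {f g : RhoSeries} {m : ℕ} (h : ∀ q ≤ m, f q = g q) :
    mulSeries C f m = mulSeries C g m := by
  funext θ s
  refine Finset.sum_congr rfl fun p hp => ?_
  rw [h p.2 (by have := Finset.HasAntidiagonal.mem_antidiagonal.1 hp; omega)]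

section Coefficients

variable (x : Input)

theorem isCosSeries_hInvSeries_mul {w : ℝ → ℝ} (hw : SmoothPeriodic w) :
    IsCosSeries fun p θ s => hInvSeries x.axis p θ s * (w s : ℂ) := by
  refine ⟨fun p s => ((curvature x.axis s ^ p / speed x.axis s * w s : ℝ) : ℂ), fun p => ?_,
    fun p θ s => ?_⟩
  · exact (((x.smoothPeriodic_curvature.pow p).div x.smoothPeriodic_speed
      fun s => (x.speed_pos s).ne').mul hw).ofReal
  · simp only [hInvSeries]
    push_cast
    ring

theorem isCosSeries_coeffD : IsCosSeries (coeffD x.axis) := by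
  have h := isCosSeries_hInvSeries_mul x (smoothPeriodic_const (1 : ℝ))
  simp only [Complex.ofReal_one, mul_one] at h
  exact h

theorem isCosSeries_coeffC : IsCosSeries (coeffC x.axis) := by
  obtain ⟨c, hc, h⟩ := isCosSeries_hInvSeries_mul x
    (x.smoothPeriodic_speed.mul x.smoothPeriodic_torsion)
  refine ⟨fun p s => -1 * c p s, fun p => (smoothPeriodic_const (-1 : ℂ)).mul (hc p),
    fun p θ s => ?_⟩
  rw [mul_assoc, ← h]
  simp [coeffC, mulSeries_ofAxis]

/-- The coefficients of `𝖡` from order two on. -/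
def tailB (r : ℝ → E3) : RhoSeries := fun p => coeffB r (p + 2)

theorem isCosSeries_tailB : IsCosSeries (tailB x.axis) := by
  obtain ⟨c, hc, h⟩ := isCosSeries_hInvSeries_mul x
    ((x.smoothPeriodic_speed.pow 2).mul (x.smoothPeriodic_torsion.pow 2))
  refine ⟨c, hc, fun p θ s => ?_⟩
  rw [← h]
  simp [tailB, coeffB, hSeries, rhoSq, mulSeries_ofAxis]

theorem coeffB_one (r : ℝ → E3) : coeffB r 1 = coeffA r 1 := by
  funext θ s
  simp [coeffB, coeffA, rhoSq]

theorem coeffA_one (r : ℝ → E3) (θ s : ℝ) :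
    coeffA r 1 θ s = ((-(speed r s * curvature r s) : ℝ) : ℂ) * (Real.cos θ : ℂ) := by
  simp [coeffA, hSeries]

theorem smoothPeriodic_coeffA :
    SmoothPeriodic fun s => ((-(speed x.axis s * curvature x.axis s) : ℝ) : ℂ) :=
  ((x.smoothPeriodic_speed.mul x.smoothPeriodic_curvature).comp contDiff_neg).ofReal

/-- The top modes cancel in `m(m-1) 𝖠₁ φ_{m-1} + ∂_θ(𝖠₁ ∂_θ φ_{m-1})`. -/
theorem Trig.coeffA_cancel {k : ℕ} (hf : Trig V (k + 1) d f) :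
    Trig V k d fun i θ s =>
      ((k + 2 : ℕ) : ℂ) * (((k + 2 : ℕ) : ℂ) - 1) * coeffA x.axis 1 θ s * f i θ s +
        deriv (fun t => coeffA x.axis 1 t s * deriv (fun t' => f i t' s) t) θ := by
  induction hf with
  | mode n c hn hc =>
    have hc' := V.smul ((smoothPeriodic_const (1 / 2 : ℂ)).mul (smoothPeriodic_coeffA x)) hc
    set j : ℤ := 2 * n - (k + 1 : ℕ) with hj
    have h1 : Trig V k d fun i θ s =>
        (((k + 2 : ℕ) : ℂ) * (((k + 2 : ℕ) : ℂ) - 1) - j * (j + 1)) *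
        ((1 / 2 * ((-(speed x.axis s * curvature x.axis s) : ℝ) : ℂ) * c i s) *
          expMode (j + 1) θ) := by
      -- For `n = k + 1` the frequency is `j = k + 1`, and `(k + 2)(k + 1) - j (j + 1)` vanishes.
      -- This removes the resonant mode `e^{i(k+2)θ}`.
      rcases Nat.lt_or_ge k n with h | h
      · obtain rfl : n = k + 1 := by omega
        refine Trig.zero.congr fun i θ s => ?_
        rw [hj]
        push_cast
        ring
      · refine ((Trig.mode n _ h hc').const_mul
          (((k + 2 : ℕ) : ℂ) * (((k + 2 : ℕ) : ℂ) - 1) - j * (j + 1))).congr fun i θ s => ?_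
        rw [show j + 1 = 2 * n - k by rw [hj]; push_cast; ring]
    have h2 : Trig V k d fun i θ s =>
        (((k + 2 : ℕ) : ℂ) * (((k + 2 : ℕ) : ℂ) - 1) - j * (j - 1)) *
        ((1 / 2 * ((-(speed x.axis s * curvature x.axis s) : ℝ) : ℂ) * c i s) *
          expMode (j - 1) θ) := by
      -- The mirror case: `n = 0` gives `j = -(k + 1)`, and `j (j - 1) = (k + 2)(k + 1)`.
      rcases n with _ | n
      · refine Trig.zero.congr fun i θ s => ?_
        rw [hj]
        push_cast
        ring
      · refine ((Trig.mode n _ (by omega) hc').const_mul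
          (((k + 2 : ℕ) : ℂ) * (((k + 2 : ℕ) : ℂ) - 1) - j * (j - 1))).congr fun i θ s => ?_
        rw [show j - 1 = 2 * n - k by rw [hj]; push_cast; ring]
    refine (h1.add _ _ h2).congr fun i θ s => ?_
    have h3 : (fun t => coeffA x.axis 1 t s * deriv (fun t' => c i s * expMode j t') t) =
        fun t => (1 / 2 * ((-(speed x.axis s * curvature x.axis s) : ℝ) : ℂ) * c i s *
            (Complex.I * j)) * expMode (j + 1) t +
          (1 / 2 * ((-(speed x.axis s * curvature x.axis s) : ℝ) : ℂ) * c i s *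
            (Complex.I * j)) * expMode (j - 1) t := by
      funext t
      rw [deriv_mul_expMode, coeffA_one]
      linear_combination ((-(speed x.axis s * curvature x.axis s) : ℝ) : ℂ) *
        (Complex.I * j * c i s) * cos_mul_expMode j t
    rw [h3, deriv_fun_add ((hasDerivAt_expMode _ θ).differentiableAt.const_mul _)
      ((hasDerivAt_expMode _ θ).differentiableAt.const_mul _), deriv_mul_expMode,
      deriv_mul_expMode, coeffA_one]
    have hcos := cos_mul_expMode j θ
    push_cast at hcos ⊢
    linear_combination ((k + 2 : ℂ)) * ((k + 2 : ℂ) - 1) *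
      (-(speed x.axis s * curvature x.axis s : ℂ)) * c i s * hcos +
      (1 / 2 * (-(speed x.axis s * curvature x.axis s : ℂ)) * c i s * j *
        ((j + 1) * expMode (j + 1) θ + (j - 1) * expMode (j - 1) θ)) * Complex.I_sq
  | add f g hf' hg' hf hg =>
    refine (hf.add _ _ hg).congr fun i θ s => ?_
    have hd : ∀ {f : ι → ℝ → ℝ → ℂ}, Trig V (k + 1) d f →
        DifferentiableAt ℝ (fun t => coeffA x.axis 1 t s * deriv (fun t' => f i t' s) t) θ := by
      intro f hf
      have h := (hf.deriv_theta.cos_mul.smul (smoothPeriodic_coeffA x)).differentiable_theta i s θ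
      simpa only [coeffA_one, mul_assoc] using h
    have h1 : (fun t => coeffA x.axis 1 t s * deriv (fun t' => f i t' s + g i t' s) t) =
        fun t => coeffA x.axis 1 t s * deriv (fun t' => f i t' s) t +
          coeffA x.axis 1 t s * deriv (fun t' => g i t' s) t := by
      funext t
      rw [deriv_fun_add (hf'.differentiable_theta i s t) (hg'.differentiable_theta i s t), mul_add]
    rw [h1, deriv_fun_add (hd hf') (hd hg')]
    ring

end Coefficients

/-- The right-hand side of the equation of order `m`. -/
def rhs (r : ℝ → E3) (b : ℝ → ℝ) (φ : RhoSeries) (m : ℕ) : ℝ → ℝ → ℂ := fun θ s =>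
  - ((m : ℂ) * ((m : ℂ) - 1) * coeffA r 1 θ s * φ (m - 1) θ s)
  - dTheta (mulSeries (coeffB r) (dTheta (trunc m φ))) m θ s
  - (dTheta (mulSeries (coeffC r)
        (dS (trunc m φ) + ofAxis fun u => b u * speed r u)) (m - 2) θ s
      + dS (mulSeries (coeffC r) (dTheta (trunc m φ))) (m - 2) θ s)
  - dS (mulSeries (coeffD r)
        (dS (trunc m φ) + ofAxis fun u => b u * speed r u)) (m - 2) θ s

theorem trunc_congr {m : ℕ} {φ φ' : RhoSeries} (h : ∀ q < m, φ q = φ' q) :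
    trunc m φ = trunc m φ' := by
  funext q θ s
  by_cases hq : q < m <;> simp [trunc, hq, h]

theorem rhs_congr (r : ℝ → E3) (b : ℝ → ℝ) {φ φ' : RhoSeries} {m : ℕ} (hm : 1 ≤ m)
    (h : ∀ q < m, φ q = φ' q) : rhs r b φ m = rhs r b φ' m := by
  unfold rhs
  rw [trunc_congr h, h (m - 1) (by omega)]

theorem orderEquation_iff_rhs (x : Input) (φ : RhoSeries) (k : ℕ) :
    OrderEquation x φ (k + 2) ↔ ∀ θ s, (speed x.axis s : ℂ) *
      angular k (fun t => φ (k + 2) t s) θ = rhs x.axis x.field φ (k + 2) θ s :=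
  Iff.rfl

/-- Truncation kills the pairing with `𝖡₀`, and `𝖡₁ = 𝖠₁` is separated because it must combine with
the first term of the equation. The remaining terms involve only orders up to `k`, with modes in
range. -/
theorem mulSeries_coeffB_trunc (r : ℝ → E3) (φ : RhoSeries) (k : ℕ) :
    mulSeries (coeffB r) (dTheta (trunc (k + 2) φ)) (k + 2) = fun θ s =>
      coeffA r 1 θ s * deriv (fun t => φ (k + 1) t s) θ +
        mulSeries (tailB r) (dTheta φ) k θ s := by
  funext θ s
  unfold mulSeries
  rw [Finset.Nat.sum_antidiagonal_succ, Finset.Nat.sum_antidiagonal_succ]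
  have h0 : dTheta (trunc (k + 2) φ) (k + 2) θ s = 0 := by simp [dTheta, trunc]
  have h1 : dTheta (trunc (k + 2) φ) (k + 1) θ s = deriv (fun t => φ (k + 1) t s) θ := by
    simp [dTheta, trunc]
  rw [h0, mul_zero, zero_add]
  simp only [zero_add, coeffB_one]
  rw [h1]
  congr 1
  refine Finset.sum_congr rfl fun p hp => ?_
  have hq : p.2 < k + 2 := by have := Finset.HasAntidiagonal.mem_antidiagonal.1 hp; omega
  simp [tailB, dTheta, trunc, hq]

theorem dS_trunc {m q : ℕ} (h : q < m) (φ : RhoSeries) : dS (trunc m φ) q = dS φ q := by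
  funext θ s
  simp [dS, trunc, h]

theorem dTheta_trunc {m q : ℕ} (h : q < m) (φ : RhoSeries) :
    dTheta (trunc m φ) q = dTheta φ q := by
  funext θ s
  simp [dTheta, trunc, h]

theorem rhs_add_two (r : ℝ → E3) (b : ℝ → ℝ) (φ : RhoSeries) (k : ℕ) (θ s : ℝ) :
    rhs r b φ (k + 2) θ s =
      - (((k + 2 : ℕ) : ℂ) * (((k + 2 : ℕ) : ℂ) - 1) * coeffA r 1 θ s * φ (k + 1) θ s)
      - deriv (fun t => coeffA r 1 t s * deriv (fun t' => φ (k + 1) t' s) t +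
          mulSeries (tailB r) (dTheta φ) k t s) θ
      - (deriv (fun t => mulSeries (coeffC r) (dS φ) k t s +
            coeffC r k t s * ((b s * speed r s : ℝ) : ℂ)) θ
          + deriv (fun u => mulSeries (coeffC r) (dTheta φ) k θ u) s)
      - deriv (fun u => mulSeries (coeffD r) (dS φ) k θ u +
            coeffD r k θ u * ((b u * speed r u : ℝ) : ℂ)) s := by
  have hS : ∀ C : RhoSeries, mulSeries C
      (dS (trunc (k + 2) φ) + ofAxis fun u => b u * speed r u) k = fun θ s =>
        mulSeries C (dS φ) k θ s + C k θ s * ((b s * speed r s : ℝ) : ℂ) := by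
    intro C
    funext θ s
    rw [mulSeries_add_ofAxis, mulSeries_congr C fun q hq => dS_trunc (by omega) φ]
  have hT : mulSeries (coeffC r) (dTheta (trunc (k + 2) φ)) k =
      mulSeries (coeffC r) (dTheta φ) k :=
    mulSeries_congr _ fun q hq => dTheta_trunc (by omega) φ
  rw [rhs, dTheta, mulSeries_coeffB_trunc]
  simp only [Nat.add_sub_cancel, dTheta, dS] at hS hT ⊢
  rw [hS, hS, hT]
  rfl

/-- Degree count, with order `q` of degree `q - 1`: the `φ_{k+1}` terms carry no `s`-derivative, and
the `𝖢` terms carry one on orders up to `k`. In the `𝖣` terms two derivatives fall on order `k` only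
through `𝖣₀`; otherwise they fall on orders below `k`. Adding back the `𝖣₀` term therefore leaves
degree `k` instead of `k + 1`. -/
theorem trig_rhs_add (x : Input) {b : ℝ → ℝ} (hb : SmoothPeriodic b) {k : ℕ} {Φ : ι → RhoSeries}
    (hΦ : ∀ q < k + 2, Trig V q (q - 1) fun i => Φ i q) :
    Trig V k k fun i θ s => rhs x.axis b (Φ i) (k + 2) θ s +
      deriv (fun u => coeffD x.axis 0 θ u * deriv (fun v => Φ i k θ v) u) s := by
  have hg : SmoothPeriodic fun u => ((b u * speed x.axis u : ℝ) : ℂ) :=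
    (hb.mul x.smoothPeriodic_speed).ofReal
  have hA := (hΦ (k + 1) (by omega)).coeffA_cancel x
  have hA' : Trig V (k + 2) k fun i θ s =>
      coeffA x.axis 1 θ s * deriv (fun t => Φ i (k + 1) t s) θ :=
    ((hΦ (k + 1) (by omega)).deriv_theta.cos_mul.smul (smoothPeriodic_coeffA x)).congr
      fun i θ s => by rw [coeffA_one, mul_assoc]
  have hθ : ∀ q ≤ k, Trig V q (k - 1) fun i => dTheta (Φ i) q := fun q hq =>
    (hΦ q (by omega)).deriv_theta.mono (by omega)
  have hs : ∀ q ≤ k, Trig V q q fun i => dS (Φ i) q := fun q hq =>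
    (hΦ q (by omega)).deriv_s_pred
  have hB := (isCosSeries_tailB x).trig_mulSeries hθ
  have hg' : ∀ {C : RhoSeries} {d : ℕ}, IsCosSeries C → Trig V k d fun _ θ s =>
      C k θ s * ((b s * speed x.axis s : ℝ) : ℂ) := fun hC => hC.trig_mul k (Trig.of_axis hg)
  have hC := ((isCosSeries_coeffC x).trig_mulSeries fun q hq => (hs q hq).mono hq).add _ _
    (hg' (isCosSeries_coeffC x))
  have hC' := (isCosSeries_coeffC x).trig_mulSeries hθ
  have hD0 : Trig V k k fun i θ s => coeffD x.axis 0 θ s * deriv (fun v => Φ i k θ v) s := by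
    have := (isCosSeries_coeffD x).trig_mul 0 (hs k le_rfl)
    rwa [zero_add] at this
  -- The index pair `(0, k)` is the `𝖣₀` term. Every other pair involves an order at most `k - 1`,
  -- so a second derivative still fits in degree `k`.
  have hD : Trig V k (k - 1) fun i θ s =>
      (∑ p ∈ (Finset.HasAntidiagonal.antidiagonal k).erase (0, k), coeffD x.axis p.1 θ s * dS (Φ i) p.2 θ s) +
        coeffD x.axis k θ s * ((b s * speed x.axis s : ℝ) : ℂ) := by
    refine (Trig.sum _ (f := fun (p : ℕ × ℕ) i θ s => coeffD x.axis p.1 θ s * dS (Φ i) p.2 θ s)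
      fun p hp => ?_).add _ _ (hg' (isCosSeries_coeffD x))
    obtain ⟨hne, hp⟩ := Finset.mem_erase.1 hp
    have hp := Finset.HasAntidiagonal.mem_antidiagonal.1 hp
    have hlt : p.2 ≤ k - 1 := by
      by_contra hlt
      exact hne (Prod.ext (by simp; omega) (by simp; omega))
    have := (isCosSeries_coeffD x).trig_mul p.1 ((hs p.2 (by omega)).mono hlt)
    rwa [hp] at this
  refine ((((hA.add _ _ (hB.deriv_theta.mono (by omega))).add _ _ hC.deriv_theta).add _ _
    hC'.deriv_s_pred).add _ _ hD.deriv_s_pred).neg.congr fun i θ s => ?_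
  rw [rhs_add_two, deriv_fun_add (hA'.differentiable_theta i s θ) (hB.differentiable_theta i s θ)]
  have h : (fun u => mulSeries (coeffD x.axis) (dS (Φ i)) k θ u +
      coeffD x.axis k θ u * ((b u * speed x.axis u : ℝ) : ℂ)) = fun u =>
      coeffD x.axis 0 θ u * deriv (fun v => Φ i k θ v) u +
      ((∑ p ∈ (Finset.HasAntidiagonal.antidiagonal k).erase (0, k), coeffD x.axis p.1 θ u * dS (Φ i) p.2 θ u) +
        coeffD x.axis k θ u * ((b u * speed x.axis u : ℝ) : ℂ)) := by
    funext u
    rw [mulSeries, ← Finset.add_sum_erase _ _ (show (0, k) ∈ Finset.HasAntidiagonal.antidiagonal k by simp),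
      add_assoc]
    rfl
  rw [h, deriv_fun_add (hD0.differentiable_s i θ s) (hD.differentiable_s i θ s)]
  ring

theorem trig_rhs (x : Input) {b : ℝ → ℝ} (hb : SmoothPeriodic b) {k : ℕ} {Φ : ι → RhoSeries}
    (hΦ : ∀ q < k + 2, Trig V q (q - 1) fun i => Φ i q) :
    Trig V k (k + 1) fun i => rhs x.axis b (Φ i) (k + 2) := by
  have h := (isCosSeries_coeffD x).trig_mul 0 (hΦ k (by omega)).deriv_s_pred
  rw [zero_add] at h
  exact (((trig_rhs_add x hb hΦ).mono (Nat.le_succ k)).sub h.deriv_s).congr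
    fun i θ s => (add_sub_cancel_right _ _).symm

end

/-! ### Existence and uniqueness of the formal solution. -/

section

variable {ι : Type*} {V : Filtration ι} {m d e : ℕ} {f g : ι → ℝ → ℝ → ℂ}

/-- A single smooth periodic function, in every degree. -/
def smoothFiltration : Filtration Unit where
  mem _ c := ∀ i, SmoothPeriodic (c i)
  smooth h := h
  mono _ h := h
  const hp _ := hp
  add h h' i := (h i).add (h' i)
  smul hp h i := hp.mul (h i)
  deriv h i := (h i).deriv
  deriv_zero h i := (h i).deriv

theorem Trig.eval (hf : Trig V m d f) (i : ι) : Trig smoothFiltration m e fun _ => f i := by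
  induction hf with
  | mode n c hn hc => exact Trig.mode n (fun _ => c i) hn fun _ => V.smooth hc i
  | add f g _ _ hf hg => exact hf.add _ _ hg

theorem exists_speed_mul_angular_eq (x : Input) (hf : Trig V m d f) :
    ∃ g, Trig V m d g ∧
      ∀ i θ s, (speed x.axis s : ℂ) * angular m (fun t => g i t s) θ = f i θ s := by
  have hs : ∀ s, (speed x.axis s : ℂ) ≠ 0 := fun s => by exact_mod_cast (x.speed_pos s).ne'
  obtain ⟨g, hg, h⟩ := (hf.smul (x.smoothPeriodic_speed.inv
    fun s => (x.speed_pos s).ne').ofReal).exists_angular_eq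
  refine ⟨g, hg, fun i θ s => ?_⟩
  rw [h, Complex.ofReal_inv, mul_inv_cancel_left₀ (hs s)]

theorem phiIC_add_two (x : Input) (k : ℕ) (θ s : ℝ) :
    x.phiIC (k + 2) θ s = x.phiMinus (k + 2) s * expMode (-((k + 2 : ℕ) : ℤ)) θ +
      x.phiPlus (k + 2) s * expMode ((k + 2 : ℕ) : ℤ) θ := by
  simp [Input.phiIC]

/-- The frequencies `±(k + 2)` are annihilated, which is why these moments are free data. -/
theorem angular_add_phiIC (x : Input) (k : ℕ) {f : ℝ → ℂ} (hf : ContDiff ℝ ∞ f) (θ s : ℝ) :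
    angular k (fun t => x.phiIC (k + 2) t s + f t) θ = angular k f θ := by
  have h : ∀ (a : ℂ) (j : ℤ), ContDiff ℝ ∞ fun t => a * expMode j t := fun a j =>
    contDiff_const.mul (smoothPeriodic_expMode j).1
  have hIC : (fun t => x.phiIC (k + 2) t s) = fun t =>
      x.phiMinus (k + 2) s * expMode (-((k + 2 : ℕ) : ℤ)) t +
      x.phiPlus (k + 2) s * expMode ((k + 2 : ℕ) : ℤ) t :=
    funext fun t => phiIC_add_two x k t s
  rw [angular_add k (by rw [hIC]; exact (h _ _).add (h _ _)) hf, hIC,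
    angular_add k (h _ _) (h _ _), angular_mode, angular_mode]
  push_cast
  ring

theorem sum_expMode_add_two (k : ℕ) (a : ℕ → ℂ) (θ : ℝ) :
    ∑ n ∈ Finset.range (k + 2 + 1), a n * expMode (2 * n - (k + 2 : ℕ)) θ =
      a 0 * expMode (-((k + 2 : ℕ) : ℤ)) θ + a (k + 2) * expMode ((k + 2 : ℕ) : ℤ) θ +
        ∑ n ∈ Finset.range (k + 1), a (n + 1) * expMode (2 * n - k) θ := by
  have e1 : ∀ n : ℕ, (2 * ((n + 1 : ℕ) : ℤ) - ((k + 2 : ℕ) : ℤ)) = 2 * n - k := by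
    intro n
    push_cast
    ring
  rw [Finset.sum_range_succ, Finset.sum_range_succ',
    show (2 * ((k + 2 : ℕ) : ℤ) - ((k + 2 : ℕ) : ℤ)) = ((k + 2 : ℕ) : ℤ) by ring,
    show (2 * ((0 : ℕ) : ℤ) - ((k + 2 : ℕ) : ℤ)) = -((k + 2 : ℕ) : ℤ) by simp]
  simp only [e1]
  abel

/-- A solution is `φ^{(IC)}` plus the solution of a nondegenerate problem, order by order. -/
theorem isSolution_iff (x : Input) (φ : RhoSeries) :
    IsSolution x φ ↔ φ 0 = 0 ∧ φ 1 = 0 ∧ ∀ k, ∃ g : ℝ → ℝ → ℂ,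
      Trig smoothFiltration k 0 (fun _ => g) ∧
      (∀ θ s, φ (k + 2) θ s = x.phiIC (k + 2) θ s + g θ s) ∧
      ∀ θ s, (speed x.axis s : ℂ) * angular k (fun t => g t s) θ =
        rhs x.axis x.field φ (k + 2) θ s := by
  constructor
  · rintro ⟨⟨a, ha, hφ, h00, h10, h11, hIC⟩, heq⟩
    refine ⟨?_, ?_, fun k => ?_⟩
    · funext θ s
      simp [hφ, h00]
    · funext θ s
      simp [hφ, h10, h11, Finset.sum_range_succ]
    · have hg : Trig smoothFiltration k 0 fun _ θ s =>
          ∑ n ∈ Finset.range (k + 1), a (k + 2) (n + 1) s * expMode (2 * n - k) θ :=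
        Trig.sum _ (f := fun n _ θ s => a (k + 2) (n + 1) s * expMode (2 * n - k) θ)
          fun n hn => Trig.mode n (fun _ => a (k + 2) (n + 1))
            (Nat.lt_succ_iff.1 (Finset.mem_range.1 hn)) fun _ => ha _ _
      have h : ∀ θ s, φ (k + 2) θ s = x.phiIC (k + 2) θ s +
          ∑ n ∈ Finset.range (k + 1), a (k + 2) (n + 1) s * expMode (2 * n - k) θ := by
        intro θ s
        obtain ⟨h0, hm⟩ := hIC (k + 2) (by omega)
        rw [hφ, sum_expMode_add_two k fun n => a (k + 2) n s, phiIC_add_two, h0, hm]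
      refine ⟨_, hg, h, fun θ s => ?_⟩
      rw [← (orderEquation_iff_rhs x φ k).1 (heq (k + 2) (by omega)) θ s]
      simp only [h]
      rw [angular_add_phiIC x k (hg.contDiff_theta () s)]
  · rintro ⟨h0, h1, h⟩
    choose g hg hφ heq using h
    choose b hb hgb using fun k => (hg k).exists_coeff
    -- The interior coefficients come from a polynomial of order `m - 2`, whose index is shifted by
    -- one by the extra extreme mode.
    refine ⟨⟨fun m n => if m < 2 then 0 else if n = 0 then x.phiMinus m else
      if n = m then x.phiPlus m else b (m - 2) (n - 1) (), fun m n => ?_, fun m θ s => ?_,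
      by simp, by simp, by simp, fun m hm => ?_⟩, fun m hm => ?_⟩
    · dsimp only
      split_ifs with hm hn hn'
      · exact smoothPeriodic_zero
      · exact x.phiMinus_smooth m (by omega)
      · exact x.phiPlus_smooth m (by omega)
      · exact hb _ _ _
    · rcases m with _ | _ | k
      · simp [h0]
      · simp [h1]
      · change φ (k + 2) θ s = _
        rw [hφ, hgb k (), sum_expMode_add_two k fun n => (if k + 2 < 2 then (0 : ℝ → ℂ) else
            if n = 0 then x.phiMinus (k + 2) else if n = k + 2 then x.phiPlus (k + 2) else
            b (k + 2 - 2) (n - 1) ()) s, phiIC_add_two]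
        congr 1
        · simp
        · refine Finset.sum_congr rfl fun n hn => ?_
          have hn := Finset.mem_range.1 hn
          rw [if_neg (by omega), if_neg (by omega), if_neg (by omega)]
          rfl
    · dsimp only
      rw [if_neg (by omega), if_pos rfl, if_neg (by omega), if_neg (by omega), if_pos rfl]
      exact ⟨rfl, rfl⟩
    · obtain ⟨k, rfl⟩ := Nat.exists_eq_add_of_le' hm
      rw [orderEquation_iff_rhs]
      intro θ s
      rw [← heq]
      simp only [hφ]
      rw [angular_add_phiIC x k ((hg k).contDiff_theta () s)]

/-- Uniqueness at a single order identifies the given solution with any candidate. A candidate built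
with degree control in `V` thus passes its bound on to the solution. -/
theorem IsSolution.apply_add_two {x : Input} {φ : RhoSeries} (h : IsSolution x φ) {k : ℕ}
    (hf : Trig V k d f) (i : ι) (heq : ∀ θ s, (speed x.axis s : ℂ) *
      angular k (fun t => f i t s) θ = rhs x.axis x.field φ (k + 2) θ s) (θ s : ℝ) :
    φ (k + 2) θ s = x.phiIC (k + 2) θ s + f i θ s := by
  obtain ⟨-, -, h⟩ := (isSolution_iff x φ).1 h
  obtain ⟨g, hg, hφ, hgeq⟩ := h k
  rw [hφ, hg.eq_of_angular_eq (hf.eval (e := 0) i) () s fun θ => ?_]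
  have hs : (speed x.axis s : ℂ) ≠ 0 := by exact_mod_cast (x.speed_pos s).ne'
  exact mul_left_cancel₀ hs ((hgeq θ s).trans (heq θ s).symm)

theorem IsSolution.eq {x : Input} {φ φ' : RhoSeries} (h : IsSolution x φ)
    (h' : IsSolution x φ') : φ = φ' := by
  funext m
  induction m using Nat.strong_induction_on with
  | _ m ih =>
    obtain ⟨h0, h1, -⟩ := (isSolution_iff x φ).1 h
    obtain ⟨h0', h1', hk⟩ := (isSolution_iff x φ').1 h'
    rcases m with _ | _ | k
    · rw [h0, h0']
    · rw [zero_add, h1, h1']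
    · obtain ⟨g, hg, hφ, hgeq⟩ := hk k
      funext θ s
      rw [hφ]
      refine h.apply_add_two hg () (fun θ s => ?_) θ s
      rw [hgeq, rhs_congr _ _ (by omega) ih]

/-- The solution `g` of `speed * (m² + ∂_θ²) g = f` with Fourier modes of order at most `m - 2`. -/
def solveOrder (x : Input) (m : ℕ) (f : ℝ → ℝ → ℂ) : ℝ → ℝ → ℂ :=
  -- The choice is meaningful only when `f` has no modes beyond `m - 2`; for the recursion,
  -- `trig_rhs` ensures this.
  Classical.epsilon fun g => Trig smoothFiltration (m - 2) 0 (fun _ => g) ∧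
    ∀ θ s, (speed x.axis s : ℂ) * angular (m - 2) (fun t => g t s) θ = f θ s

/-- The solution of the near-axis problem. -/
def solution (x : Input) : ℕ → ℝ → ℝ → ℂ
  | m => if m < 2 then 0 else x.phiIC m + solveOrder x m
      -- The cut-off makes the recursion well founded. It is harmless by `rhs_congr`, as only orders
      -- below `m` enter.
      (rhs x.axis x.field (fun q => if _ : q < m then solution x q else 0) m)

theorem isSolution_solution (x : Input) : IsSolution x (solution x) := by
  have hstep : ∀ m, 2 ≤ m → solution x m =
      x.phiIC m + solveOrder x m (rhs x.axis x.field (solution x) m) := by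
    intro m hm
    rw [solution, if_neg (by omega), rhs_congr _ _ (by omega) (φ' := solution x)]
    intro q hq
    simp [hq]
  have h0 : solution x 0 = 0 := by rw [solution]; simp
  have h1 : solution x 1 = 0 := by rw [solution]; simp
  have hzero : ∀ q < 2, Trig smoothFiltration q 0 fun _ => solution x q := by
    intro q hq
    interval_cases q
    · rw [h0]; exact Trig.zero
    · rw [h1]; exact Trig.zero
  have key : ∀ k, (∀ q < k + 2, Trig smoothFiltration q 0 fun _ => solution x q) →
      Trig smoothFiltration k 0 (fun _ => solveOrder x (k + 2)
        (rhs x.axis x.field (solution x) (k + 2))) ∧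
      ∀ θ s, (speed x.axis s : ℂ) * angular k (fun t => solveOrder x (k + 2)
        (rhs x.axis x.field (solution x) (k + 2)) t s) θ =
          rhs x.axis x.field (solution x) (k + 2) θ s := by
    intro k hk
    obtain ⟨g, hg, hgeq⟩ := exists_speed_mul_angular_eq x
      (trig_rhs (V := smoothFiltration) x x.field_smooth (Φ := fun _ => solution x) (k := k)
        fun q hq => (hk q hq).mono (Nat.zero_le _))
    exact Classical.epsilon_spec (p := fun g => Trig smoothFiltration k 0 (fun _ => g) ∧
      ∀ θ s, (speed x.axis s : ℂ) * angular k (fun t => g t s) θ =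
        rhs x.axis x.field (solution x) (k + 2) θ s) ⟨g (), hg.eval (), hgeq ()⟩
  have hIC : ∀ k, Trig smoothFiltration (k + 2) 0 fun _ => x.phiIC (k + 2) := by
    intro k
    refine ((Trig.mode 0 (fun _ => x.phiMinus (k + 2)) (by omega)
      fun _ => x.phiMinus_smooth _ (by omega)).add _ _
      (Trig.mode (k + 2) (fun _ => x.phiPlus (k + 2)) (by omega)
      fun _ => x.phiPlus_smooth _ (by omega))).congr fun i θ s => ?_
    rw [phiIC_add_two]
    congr 3
    push_cast
    ring
  have htrig : ∀ m, Trig smoothFiltration m 0 fun _ => solution x m := by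
    intro m
    induction m using Nat.strong_induction_on with
    | _ m ih =>
      rcases m with _ | _ | k
      · exact hzero 0 (by omega)
      · exact hzero 1 (by omega)
      · rw [hstep (k + 2) (by omega)]
        exact (hIC k).add _ _ (key k ih).1.raise
  refine (isSolution_iff x _).2 ⟨h0, h1, fun k => ⟨_, (key k fun q _ => htrig q).1,
    fun θ s => ?_, (key k fun q _ => htrig q).2⟩⟩
  rw [hstep (k + 2) (by omega)]
  rfl

theorem existsUnique_isSolution (x : Input) : ∃! φ : RhoSeries, IsSolution x φ :=
  ⟨solution x, isSolution_solution x, fun _ h => h.eq (isSolution_solution x)⟩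

end

/-! ### Families oscillating at frequency `N`, graded by powers of `N`. -/

/-- The rapidly oscillating families `N ↦ N^{i-M} e^{ikNs} p(s)`. -/
def wave (M i : ℕ) (k : ℤ) (p : ℝ → ℂ) (N : ℕ) (s : ℝ) : ℂ :=
  ((N : ℂ) ^ M)⁻¹ * (N : ℂ) ^ i * (expMode (k * N) s * p s)

theorem smoothPeriodic_wave (M i : ℕ) (k : ℤ) {p : ℝ → ℂ} (hp : SmoothPeriodic p) (N : ℕ) :
    SmoothPeriodic (wave M i k p N) :=
  (smoothPeriodic_const _).mul ((smoothPeriodic_expMode _).mul hp)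

theorem mul_wave (M i : ℕ) (k : ℤ) (p q : ℝ → ℂ) (N : ℕ) (s : ℝ) :
    q s * wave M i k p N s = wave M i k (fun u => q u * p u) N s := by
  simp only [wave]
  ring

theorem deriv_wave (M i : ℕ) (k : ℤ) {p : ℝ → ℂ} (hp : SmoothPeriodic p) (N : ℕ) (s : ℝ) :
    deriv (wave M i k p N) s =
      wave M (i + 1) k (fun u => Complex.I * k * p u) N s + wave M i k (deriv p) N s := by
  have h := ((hasDerivAt_expMode (k * N) s).mul (hp.differentiable s).hasDerivAt).const_mul
    (((N : ℂ) ^ M)⁻¹ * (N : ℂ) ^ i)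
  have h' : deriv (wave M i k p N) s = _ := h.deriv
  rw [h']
  simp only [wave]
  push_cast
  ring

/-- Sums of functions independent of `N` and of waves `N^{i-M} e^{ikNs} p(s)` with `i < d`. -/
inductive IsWave (M d : ℕ) : (ℕ → ℝ → ℂ) → Prop
  | const (p : ℝ → ℂ) : SmoothPeriodic p → IsWave M d fun _ => p
  | wave (i : ℕ) (k : ℤ) (p : ℝ → ℂ) : i < d → SmoothPeriodic p → IsWave M d (wave M i k p)
  | add (c c' : ℕ → ℝ → ℂ) : IsWave M d c → IsWave M d c' →
      IsWave M d fun N s => c N s + c' N s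

theorem IsWave.mono {M d e : ℕ} {c : ℕ → ℝ → ℂ} (hde : d ≤ e) (hc : IsWave M d c) :
    IsWave M e c := by
  induction hc with
  | const p hp => exact .const p hp
  | wave i k p hi hp => exact .wave i k p (hi.trans_le hde) hp
  | add c c' _ _ hc hc' => exact hc.add _ _ hc'

theorem IsWave.smooth {M d : ℕ} {c : ℕ → ℝ → ℂ} (hc : IsWave M d c) (N : ℕ) :
    SmoothPeriodic (c N) := by
  induction hc with
  | const p hp => exact hp
  | wave i k p hi hp => exact smoothPeriodic_wave M i k hp N
  | add c c' _ _ hc hc' => exact hc.add hc'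

theorem IsWave.smul {M d : ℕ} {c : ℕ → ℝ → ℂ} {q : ℝ → ℂ} (hq : SmoothPeriodic q)
    (hc : IsWave M d c) : IsWave M d fun N s => q s * c N s := by
  induction hc with
  | const p hp => exact .const _ (hq.mul hp)
  | wave i k p hi hp =>
    simp only [mul_wave]
    exact .wave i k _ hi (hq.mul hp)
  | add c c' _ _ hc hc' =>
    simp only [mul_add]
    exact hc.add _ _ hc'

theorem IsWave.deriv {M d : ℕ} {c : ℕ → ℝ → ℂ} (hc : IsWave M d c) :
    IsWave M (d + 1) fun N => deriv (c N) := by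
  induction hc with
  | const p hp => exact .const _ hp.deriv
  | wave i k p hi hp =>
    have h : (fun N => _root_.deriv (NearAxis.wave M i k p N)) = fun N s =>
        NearAxis.wave M (i + 1) k (fun u => Complex.I * k * p u) N s +
          NearAxis.wave M i k (_root_.deriv p) N s :=
      funext fun N => funext fun s => deriv_wave M i k hp N s
    rw [h]
    exact .add _ _ (.wave _ k _ (by omega) ((smoothPeriodic_const _).mul hp))
      (.wave _ k _ (by omega) hp.deriv)
  | add c c' hc hc' ih ih' =>
    have h : (fun N => _root_.deriv fun s => c N s + c' N s) =
        fun N s => _root_.deriv (c N) s + _root_.deriv (c' N) s :=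
      funext fun N => funext fun s =>
        deriv_fun_add ((hc.smooth N).differentiable s) ((hc'.smooth N).differentiable s)
    rw [h]
    exact ih.add _ _ ih'

theorem IsWave.deriv_zero {M : ℕ} {c : ℕ → ℝ → ℂ} (hc : IsWave M 0 c) :
    IsWave M 0 fun N => _root_.deriv (c N) := by
  induction hc with
  | const p hp => exact .const _ hp.deriv
  | wave i k p hi hp => omega
  | add c c' hc hc' ih ih' =>
    have h : (fun N => _root_.deriv fun s => c N s + c' N s) =
        fun N s => _root_.deriv (c N) s + _root_.deriv (c' N) s :=
      funext fun N => funext fun s =>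
        deriv_fun_add ((hc.smooth N).differentiable s) ((hc'.smooth N).differentiable s)
    rw [h]
    exact ih.add _ _ ih'

/-- The filtration of oscillating families by powers of the frequency. -/
def waveFiltration (M : ℕ) : Filtration ℕ where
  mem d c := IsWave M d c
  smooth := IsWave.smooth
  mono := IsWave.mono
  const := .const _
  add := .add _ _
  smul := IsWave.smul
  deriv := IsWave.deriv
  deriv_zero := IsWave.deriv_zero

theorem SmoothPeriodic.exists_norm_le {F : Type*} [NormedAddCommGroup F] [NormedSpace ℝ F]
    {f : ℝ → F} (hf : SmoothPeriodic f) : ∃ C, 0 ≤ C ∧ ∀ s, ‖f s‖ ≤ C := by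
  obtain ⟨C, hC⟩ := isCompact_Icc.exists_bound_of_continuousOn
    (s := Set.Icc 0 (2 * Real.pi)) hf.1.continuous.continuousOn
  refine ⟨C, (norm_nonneg _).trans (hC 0 ⟨le_rfl, Real.two_pi_pos.le⟩), fun s => ?_⟩
  obtain ⟨t, ht, hst⟩ := hf.2.exists_mem_Ico₀ Real.two_pi_pos s
  rw [hst]
  exact hC t ⟨ht.1, ht.2.le⟩

/-- The strict bound `i < M + 1 + q` makes `N^q` the largest power of `N` that can occur. -/
theorem IsWave.exists_norm_le {M q : ℕ} {c : ℕ → ℝ → ℂ} (hc : IsWave M (M + 1 + q) c) :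
    ∃ C, 0 ≤ C ∧ ∀ N : ℕ, 1 ≤ N → ∀ s, ‖c N s‖ ≤ C * (N : ℝ) ^ q := by
  induction hc with
  | const p hp =>
    obtain ⟨C, h0, hC⟩ := hp.exists_norm_le
    refine ⟨C, h0, fun N hN s => (hC s).trans (le_mul_of_one_le_right h0 ?_)⟩
    exact one_le_pow₀ (by exact_mod_cast hN)
  | wave i k p hi hp =>
    obtain ⟨C, h0, hC⟩ := hp.exists_norm_le
    refine ⟨C, h0, fun N hN s => ?_⟩
    have hN' : (1 : ℝ) ≤ N := by exact_mod_cast hN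
    have hpos : (0 : ℝ) < (N : ℝ) ^ M := by positivity
    have h1 : ((N : ℝ) ^ M)⁻¹ * (N : ℝ) ^ i ≤ (N : ℝ) ^ q := by
      rw [inv_mul_le_iff₀ hpos, ← pow_add]
      exact pow_le_pow_right₀ hN' (by omega)
    rw [NearAxis.wave, norm_mul, norm_mul, norm_mul, norm_expMode, one_mul, norm_inv, norm_pow,
      norm_pow, Complex.norm_natCast, mul_comm C]
    exact mul_le_mul h1 (hC s) (norm_nonneg _) (by positivity)
  | add c c' _ _ hc hc' =>
    obtain ⟨C, h0, hC⟩ := hc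
    obtain ⟨C', h0', hC'⟩ := hc'
    refine ⟨C + C', add_nonneg h0 h0', fun N hN s => ?_⟩
    rw [add_mul]
    exact norm_add_le_of_le (hC N hN s) (hC' N hN s)

theorem Trig.exists_norm_le {M q m : ℕ} {f : ℕ → ℝ → ℝ → ℂ}
    (hf : Trig (waveFiltration M) m (M + 1 + q) f) :
    ∃ C, 0 ≤ C ∧ ∀ N : ℕ, 1 ≤ N → ∀ θ s, ‖f N θ s‖ ≤ C * (N : ℝ) ^ q := by
  induction hf with
  | mode n c hn hc =>
    obtain ⟨C, h0, hC⟩ := IsWave.exists_norm_le hc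
    refine ⟨C, h0, fun N hN θ s => ?_⟩
    rw [norm_mul, norm_expMode, mul_one]
    exact hC N hN s
  | add f g _ _ hf hg =>
    obtain ⟨C, h0, hC⟩ := hf
    obtain ⟨C', h0', hC'⟩ := hg
    refine ⟨C + C', add_nonneg h0 h0', fun N hN θ s => ?_⟩
    rw [add_mul]
    exact norm_add_le_of_le (hC N hN θ s) (hC' N hN θ s)

/-! ### The perturbation and the leading waves. -/

/-- The input `x` with `N^{-M} e^{iNs}` added to `φ₂₀` and `N^{-M} e^{-iNs}` to `φ₂₂`. -/
def perturb (x : Input) (M N : ℕ) : Input where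
  axis := x.axis
  field := x.field
  phiMinus m s := x.phiMinus m s + if m = 2 then wave M 0 1 1 N s else 0
  phiPlus m s := x.phiPlus m s + if m = 2 then wave M 0 (-1) 1 N s else 0
  axis_smooth := x.axis_smooth
  field_smooth := x.field_smooth
  phiMinus_smooth m hm := by
    refine (x.phiMinus_smooth m hm).add ?_
    split_ifs
    · exact smoothPeriodic_wave _ _ _ (smoothPeriodic_const 1) N
    · exact smoothPeriodic_zero
  phiPlus_smooth m hm := by
    refine (x.phiPlus_smooth m hm).add ?_
    split_ifs
    · exact smoothPeriodic_wave _ _ _ (smoothPeriodic_const 1) N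
    · exact smoothPeriodic_zero
  speed_pos := x.speed_pos
  curvature_pos := x.curvature_pos

/-- The two added waves are complex conjugates, and the field is untouched. -/
theorem perturb_mem_physicalInputs {x : Input} (hx : x ∈ physicalInputs) (M N : ℕ) :
    perturb x M N ∈ physicalInputs := by
  refine ⟨hx.1, fun m hm s => ?_⟩
  simp only [perturb, map_add, hx.2 m hm s]
  split_ifs
  · simp [wave, conj_expMode]
  · simp

/-- `N^{i-M} p(s) (e^{i(Ns-2θ)} + e^{-i(Ns-2θ)})`. -/
def lead (M i : ℕ) (p : ℝ → ℂ) (N : ℕ) (θ s : ℝ) : ℂ :=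
  wave M i 1 p N s * expMode (-2) θ + wave M i (-1) p N s * expMode 2 θ

theorem trig_mode_neg_two {V : Filtration ℕ} {j d : ℕ} {c : ℕ → ℝ → ℂ} (hc : V.mem d c) :
    Trig V (2 * j + 2) d fun N θ s => c N s * expMode (-2) θ :=
  (Trig.mode j c (by omega) hc).congr fun N θ s => by
    congr 2
    push_cast
    ring

theorem trig_mode_two {V : Filtration ℕ} {j d : ℕ} {c : ℕ → ℝ → ℂ} (hc : V.mem d c) :
    Trig V (2 * j + 2) d fun N θ s => c N s * expMode 2 θ :=
  (Trig.mode (j + 2) c (by omega) hc).congr fun N θ s => by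
    congr 2
    push_cast
    ring

theorem trig_lead {M i j d : ℕ} (hi : i < d) {p : ℝ → ℂ} (hp : SmoothPeriodic p) :
    Trig (waveFiltration M) (2 * j + 2) d (lead M i p) :=
  (trig_mode_neg_two (V := waveFiltration M) (.wave i 1 p hi hp)).add _ _
    (trig_mode_two (V := waveFiltration M) (.wave i (-1) p hi hp))

theorem angular_lead (k M i : ℕ) (p : ℝ → ℂ) (N : ℕ) (θ s : ℝ) :
    angular k (fun t => lead M i p N t s) θ = (((k + 2 : ℕ) : ℂ) ^ 2 - 4) * lead M i p N θ s := by
  have h : ∀ (a : ℂ) (j : ℤ), ContDiff ℝ ∞ fun t => a * expMode j t := fun a j =>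
    contDiff_const.mul (smoothPeriodic_expMode j).1
  simp only [lead]
  rw [angular_add k (h _ _) (h _ _), angular_mode, angular_mode]
  push_cast
  ring

/-- Two derivatives of a wave multiply it by `-k² N²`, up to lower powers of `N`. -/
theorem isWave_second_deriv (M i : ℕ) (k : ℤ) {p q : ℝ → ℂ} (hp : SmoothPeriodic p)
    (hq : SmoothPeriodic q) :
    IsWave M (i + 2) fun N s => deriv (fun u => q u * deriv (wave M i k p N) u) s +
      (k : ℂ) ^ 2 * wave M (i + 2) k (fun u => q u * p u) N s := by
  have hp1 : SmoothPeriodic fun u => q u * (Complex.I * k * p u) :=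
    hq.mul ((smoothPeriodic_const _).mul hp)
  have hp2 : SmoothPeriodic fun u => q u * deriv p u := hq.mul hp.deriv
  have h : (fun N s => deriv (fun u => q u * deriv (wave M i k p N) u) s +
      (k : ℂ) ^ 2 * wave M (i + 2) k (fun u => q u * p u) N s) = fun N s =>
      wave M (i + 1) k (deriv fun u => q u * (Complex.I * k * p u)) N s +
      deriv (wave M i k (fun u => q u * deriv p u) N) s := by
    funext N s
    have h1 : (fun u => q u * deriv (wave M i k p N) u) = fun u =>
        wave M (i + 1) k (fun u => q u * (Complex.I * k * p u)) N u +
          wave M i k (fun u => q u * deriv p u) N u := by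
      funext u
      rw [deriv_wave M i k hp, mul_add, mul_wave, mul_wave]
    rw [h1, deriv_fun_add ((smoothPeriodic_wave M _ k hp1 N).differentiable s)
      ((smoothPeriodic_wave M _ k hp2 N).differentiable s), deriv_wave M (i + 1) k hp1]
    simp only [wave]
    linear_combination (((N : ℂ) ^ M)⁻¹ * (N : ℂ) ^ (i + 2) * (expMode (k * N) s) *
      (k : ℂ) ^ 2 * (q s * p s)) * Complex.I_sq
  rw [h]
  exact .add _ _ (.wave _ k _ (by omega) hp1.deriv)
    ((IsWave.wave i k _ (Nat.lt_succ_self i) hp2).deriv)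

theorem coeffD_zero (r : ℝ → E3) (θ s : ℝ) :
    coeffD r 0 θ s = (((speed r s)⁻¹ : ℝ) : ℂ) := by
  simp [coeffD, hInvSeries]

/-- Both waves have `k² = 1`, so `∂_s 𝖣₀ ∂_s` acts to leading order as `-N² / ℓ'`; derivatives of
the coefficients cost a power of `N`. -/
theorem trig_lead_second_deriv (x : Input) (M i j : ℕ) {p : ℝ → ℂ} (hp : SmoothPeriodic p) :
    Trig (waveFiltration M) (2 * j + 2) (i + 2) fun N θ s =>
      deriv (fun u => coeffD x.axis 0 θ u * deriv (fun v => lead M i p N θ v) u) s +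
        lead M (i + 2) (fun u => (((speed x.axis u)⁻¹ : ℝ) : ℂ) * p u) N θ s := by
  have hq := (x.smoothPeriodic_speed.inv fun s => (x.speed_pos s).ne').ofReal
  refine ((trig_mode_neg_two (V := waveFiltration M)
    (isWave_second_deriv M i 1 hp hq)).add _ _ (trig_mode_two (V := waveFiltration M)
    (isWave_second_deriv M i (-1) hp hq))).congr fun N θ s => ?_
  have hw := fun k => (smoothPeriodic_wave M i k hp N).differentiable
  have hw' := fun k => (hq.mul (smoothPeriodic_wave M i k hp N).deriv).differentiable
  have h : (fun u => coeffD x.axis 0 θ u * deriv (fun v => lead M i p N θ v) u) = fun u =>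
      ((((speed x.axis u)⁻¹ : ℝ) : ℂ) * deriv (wave M i 1 p N) u) * expMode (-2) θ +
      ((((speed x.axis u)⁻¹ : ℝ) : ℂ) * deriv (wave M i (-1) p N) u) * expMode 2 θ := by
    funext u
    simp only [lead]
    rw [deriv_fun_add ((hw 1 u).mul_const _) ((hw (-1) u).mul_const _),
      deriv_mul_const (hw 1 u), deriv_mul_const (hw (-1) u), coeffD_zero]
    ring
  rw [h, deriv_fun_add ((hw' 1 s).mul_const _) ((hw' (-1) s).mul_const _),
    deriv_mul_const (hw' 1 s), deriv_mul_const (hw' (-1) s)]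
  simp only [lead]
  push_cast
  ring

/-- The amplitude of the leading part of the response at order `2j + 2`. -/
def amplitude (r : ℝ → E3) : ℕ → ℝ → ℝ
  | 0, _ => 1
  -- The constant is the angular symbol at order `2j + 4` on the modes `±2`. One factor `1/ℓ'` is
  -- `𝖣₀`, and the other comes from dividing the equation by `ℓ'`.
  | j + 1, s => ((2 * j + 4 : ℝ) ^ 2 - 4)⁻¹ *
      ((speed r s)⁻¹ * ((speed r s)⁻¹ * amplitude r j s))

theorem smoothPeriodic_amplitude (x : Input) (j : ℕ) :
    SmoothPeriodic (amplitude x.axis j) := by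
  have hq := x.smoothPeriodic_speed.inv fun s => (x.speed_pos s).ne'
  induction j with
  | zero => exact smoothPeriodic_const 1
  | succ j ih => exact (smoothPeriodic_const _).mul (hq.mul (hq.mul ih))

theorem amplitude_denominator_pos (j : ℕ) : (0 : ℝ) < (2 * j + 4 : ℝ) ^ 2 - 4 := by
  have h : (0 : ℝ) ≤ j := Nat.cast_nonneg j
  nlinarith

theorem amplitude_pos (x : Input) (j : ℕ) (s : ℝ) : 0 < amplitude x.axis j s := by
  induction j with
  | zero => exact one_pos
  | succ j ih =>
    have h := inv_pos.2 (x.speed_pos s)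
    exact mul_pos (inv_pos.2 (amplitude_denominator_pos j)) (mul_pos h (mul_pos h ih))

theorem exists_le_amplitude (x : Input) (j : ℕ) :
    ∃ c, 0 < c ∧ ∀ s, c ≤ amplitude x.axis j s := by
  obtain ⟨C, h0, hC⟩ := ((smoothPeriodic_amplitude x j).inv
    fun s => (amplitude_pos x j s).ne').exists_norm_le
  refine ⟨(C + 1)⁻¹, by positivity, fun s => ?_⟩
  have hs := amplitude_pos x j s
  rw [inv_le_comm₀ (by positivity) hs]
  have := hC s
  rw [Real.norm_of_nonneg (by positivity)] at this
  linarith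

/-! ### Leading asymptotics of the response. -/

theorem trig_phiIC_perturb (x : Input) (M k : ℕ) :
    Trig (waveFiltration M) (k + 2) (k + 1) fun N => (perturb x M N).phiIC (k + 2) := by
  have hc : ∀ {p : ℝ → ℂ} (j : ℤ), SmoothPeriodic p → (waveFiltration M).mem (k + 1)
      fun N s => p s + if k + 2 = 2 then wave M 0 j 1 N s else 0 := by
    intro p j hp
    by_cases hk : k + 2 = 2
    · simp only [if_pos hk]
      exact IsWave.add _ _ (.const p hp) (.wave 0 j 1 (by omega) (smoothPeriodic_const 1))
    · simp only [if_neg hk, add_zero]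
      exact IsWave.const p hp
  refine ((Trig.mode 0 _ (by omega) (hc 1 (x.phiMinus_smooth (k + 2) (by omega)))).add _ _
    (Trig.mode (k + 2) _ (by omega)
      (hc (-1) (x.phiPlus_smooth (k + 2) (by omega))))).congr fun N θ s => ?_
  rw [phiIC_add_two]
  simp only [perturb]
  congr 3
  push_cast
  ring

theorem phiIC_perturb (x : Input) (M N m : ℕ) (θ s : ℝ) :
    (perturb x M N).phiIC m θ s = x.phiIC m θ s + if m = 2 then lead M 0 1 N θ s else 0 := by
  by_cases hm : m = 2
  · subst hm
    simp only [Input.phiIC, perturb, lead, le_refl, if_true]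
    push_cast
    ring
  · simp [Input.phiIC, perturb, hm]

theorem trig_phiIC (x : Input) (M d k : ℕ) :
    Trig (waveFiltration M) (k + 2) d fun _ => x.phiIC (k + 2) := by
  refine ((Trig.mode 0 _ (by omega) (IsWave.const _ (x.phiMinus_smooth (k + 2)
    (by omega)))).add _ _ (Trig.mode (k + 2) _ (by omega)
    (IsWave.const _ (x.phiPlus_smooth (k + 2) (by omega))))).congr fun N θ s => ?_
  rw [phiIC_add_two]
  congr 3
  push_cast
  ring

/-- The perturbation enters at order two with exponent `i = 0`, and each further order adds at most
one power of `N`: order `m` reaches at most `i = m - 2`. -/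
theorem trig_response {x : Input} {M : ℕ} {Φ : ℕ → RhoSeries}
    (hΦ : ∀ N, IsSolution (perturb x M N) (Φ N)) (m : ℕ) : Trig (waveFiltration M) m (m - 1) fun N => Φ N m := by
  have h := fun N => (isSolution_iff _ _).1 (hΦ N)
  induction m using Nat.strong_induction_on with
  | _ m ih =>
    rcases m with _ | _ | k
    · exact Trig.zero.congr fun N θ s => by simp [(h N).1]
    · exact Trig.zero.congr fun N θ s => by simp [(h N).2.1]
    · obtain ⟨g, hg, hgeq⟩ := exists_speed_mul_angular_eq x (trig_rhs x x.field_smooth ih)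
      exact ((trig_phiIC_perturb x M k).add _ _ hg.raise).congr fun N θ s =>
        (hΦ N).apply_add_two hg N (fun θ s => hgeq N θ s) θ s

/-- At even orders the top power `i = 2j` is entirely in `lead`. Two orders further only the `𝖣₀`
term can raise it by two, and its sign agrees with that of the angular symbol, so the amplitude
stays positive and nothing cancels. -/
theorem trig_response_sub_lead {x : Input} {M : ℕ} {Φ : ℕ → RhoSeries}
    (hΦ : ∀ N, IsSolution (perturb x M N) (Φ N)) (j : ℕ) : Trig (waveFiltration M) (2 * j + 2) (2 * j)
    fun N θ s => Φ N (2 * j + 2) θ s -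
      lead M (2 * j) (fun u => (amplitude x.axis j u : ℂ)) N θ s := by
  have h := fun N => (isSolution_iff _ _).1 (hΦ N)
  induction j with
  | zero =>
    -- The subtracted `𝖣₀` term acts on `φ₀ = 0`, so the right-hand side at order two does not see
    -- the perturbation.
    have hR := trig_rhs_add x x.field_smooth (k := 0) fun q _ => trig_response hΦ q
    obtain ⟨g, hg, hgeq⟩ := exists_speed_mul_angular_eq x hR
    refine ((trig_phiIC x M 0 0).add _ _ hg.raise).congr fun N θ s => ?_
    have h0 := (h N).1
    rw [Nat.mul_zero, zero_add, (hΦ N).apply_add_two hg N (fun θ s => ?_) θ s, phiIC_perturb]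
    · simp only [if_true, amplitude, Complex.ofReal_one]
      rw [show (fun _ : ℝ => (1 : ℂ)) = 1 from rfl]
      ring
    · refine (hgeq N θ s).trans ?_
      simp [h0]
      rfl
  | succ j ih =>
    have hR := trig_rhs_add x x.field_smooth (k := 2 * j + 2) fun q _ => trig_response hΦ q
    have hp := (smoothPeriodic_amplitude x j).ofReal
    have hp' := (smoothPeriodic_amplitude x (j + 1)).ofReal
    have hl := (x.smoothPeriodic_speed.inv fun s => (x.speed_pos s).ne').ofReal
    have hs1 : Trig (waveFiltration M) (2 * j + 2) (2 * j + 1) fun N θ s =>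
        coeffD x.axis 0 θ s * deriv (fun v => Φ N (2 * j + 2) θ v -
          lead M (2 * j) (fun u => (amplitude x.axis j u : ℂ)) N θ v) s :=
      (ih.deriv_s.smul hl).congr fun N θ s => by rw [coeffD_zero]
    have hs2 : Trig (waveFiltration M) (2 * j + 2) (2 * j + 2) fun N θ s =>
        coeffD x.axis 0 θ s * deriv (fun v =>
          lead M (2 * j) (fun u => (amplitude x.axis j u : ℂ)) N θ v) s :=
      ((trig_lead (i := 2 * j) (d := 2 * j + 1) (by omega) hp).deriv_s.smul hl).congr
        fun N θ s => by rw [coeffD_zero]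
    -- The previous remainder has degree `2j`, so its two derivatives are absorbed in degree `2j +
    -- 2`. Only the derivatives of the previous leading wave produce the power `N^{2j+2-M}`.
    have hR' : Trig (waveFiltration M) (2 * j + 2) (2 * j + 2) fun N θ s =>
        rhs x.axis x.field (Φ N) (2 * j + 2 + 2) θ s - lead M (2 * j + 2)
          (fun u => (((speed x.axis u)⁻¹ : ℝ) : ℂ) * (amplitude x.axis j u : ℂ)) N θ s := by
      refine ((hR.sub hs1.deriv_s).sub (trig_lead_second_deriv x M (2 * j) j hp)).congr
        fun N θ s => ?_
      have hsplit : (fun u => coeffD x.axis 0 θ u * deriv (fun v => Φ N (2 * j + 2) θ v) u) =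
          fun u => coeffD x.axis 0 θ u * deriv (fun v => Φ N (2 * j + 2) θ v -
            lead M (2 * j) (fun u => (amplitude x.axis j u : ℂ)) N θ v) u +
          coeffD x.axis 0 θ u * deriv (fun v =>
            lead M (2 * j) (fun u => (amplitude x.axis j u : ℂ)) N θ v) u := by
        funext u
        rw [← mul_add, ← deriv_fun_add (ih.differentiable_s N θ u)
          ((trig_lead (j := j) (d := 2 * j + 1) (by omega) hp).differentiable_s N θ u)]
        simp only [sub_add_cancel]
      rw [hsplit, deriv_fun_add (hs1.differentiable_s N θ s) (hs2.differentiable_s N θ s)]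
      ring
    obtain ⟨g, hg, hgeq⟩ := exists_speed_mul_angular_eq x hR'
    have hlead : Trig (waveFiltration M) (2 * j + 2) (2 * j + 3)
      (lead M (2 * (j + 1)) fun u => (amplitude x.axis (j + 1) u : ℂ)) :=
      trig_lead (by omega) hp'
    have hg' := (hg.mono (Nat.le_succ _)).add _ _ hlead
    have hsol : ∀ N θ s, Φ N (2 * j + 2 + 2) θ s = x.phiIC (2 * j + 2 + 2) θ s + (g N θ s +
        lead M (2 * (j + 1)) (fun u => (amplitude x.axis (j + 1) u : ℂ)) N θ s) := by
      intro N θ s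
      rw [(hΦ N).apply_add_two hg' N (fun θ s => ?_) θ s, phiIC_perturb, if_neg (by omega),
        add_zero]
      change (speed x.axis s : ℂ) * _ = rhs x.axis x.field _ _ θ s
      rw [angular_add _ (hg.contDiff_theta N s) (hlead.contDiff_theta N s), mul_add]
      refine (congrArg₂ (· + ·) (hgeq N θ s) rfl).trans ?_
      rw [angular_lead]
      have hamp : (speed x.axis s : ℂ) * ((((2 * j + 2 + 2 : ℕ) : ℂ) ^ 2 - 4) *
          (amplitude x.axis (j + 1) s : ℂ)) =
          (((speed x.axis s)⁻¹ : ℝ) : ℂ) * (amplitude x.axis j s : ℂ) := by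
        have hreal : speed x.axis s * (((2 * j + 4 : ℝ) ^ 2 - 4) * amplitude x.axis (j + 1) s) =
            (speed x.axis s)⁻¹ * amplitude x.axis j s := by
          rw [amplitude, mul_inv_cancel_left₀ (amplitude_denominator_pos j).ne',
            mul_inv_cancel_left₀ (x.speed_pos s).ne']
        have hcomplex := congrArg (fun a : ℝ => (a : ℂ)) hreal
        push_cast at hcomplex ⊢
        linear_combination hcomplex
      simp only [lead, wave]
      linear_combination (((N : ℂ) ^ M)⁻¹ * (N : ℂ) ^ (2 * j + 2) *
        (expMode (1 * N) s * expMode (-2) θ + expMode (-1 * N) s * expMode 2 θ)) * hamp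
    refine ((trig_phiIC x M (2 * (j + 1)) (2 * j + 2)).add _ _ hg.raise).congr fun N θ s => ?_
    rw [show 2 * (j + 1) + 2 = 2 * j + 2 + 2 by ring, hsol]
    ring

/-! ### Smallness of the perturbation in the input norms. -/

theorem cNorm_zero {F : Type*} [NormedAddCommGroup F] [NormedSpace ℝ F] (k : ℕ) :
    cNorm k (0 : ℝ → F) = 0 := by
  simp [cNorm]

theorem sobolevNorm_zero (k : ℕ) : sobolevNorm k 0 = 0 := by
  simp [sobolevNorm]

theorem iteratedDeriv_two_expMode (n : ℕ) (a a' : ℂ) (k k' : ℤ) :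
    iteratedDeriv n (fun t => a * expMode k t + a' * expMode k' t) = fun t =>
      a * (Complex.I * k) ^ n * expMode k t + a' * (Complex.I * k') ^ n * expMode k' t := by
  induction n with
  | zero => simp
  | succ n ih =>
    funext t
    rw [iteratedDeriv_succ, ih, deriv_fun_add
      ((hasDerivAt_expMode _ t).differentiableAt.const_mul _)
      ((hasDerivAt_expMode _ t).differentiableAt.const_mul _), deriv_mul_expMode,
      deriv_mul_expMode]
    ring

theorem mixedDeriv_lead (M a b N : ℕ) (θ s : ℝ) :
    mixedDeriv a b (lead M 0 1 N) θ s =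
      ((N : ℂ) ^ M)⁻¹ * (Complex.I * N) ^ b * expMode N s * (Complex.I * (-2)) ^ a *
          expMode (-2) θ +
        ((N : ℂ) ^ M)⁻¹ * (Complex.I * (-N)) ^ b * expMode (-N) s * (Complex.I * 2) ^ a *
          expMode 2 θ := by
  have h1 : ∀ t, (fun u => lead M 0 1 N t u) = fun u =>
      (((N : ℂ) ^ M)⁻¹ * expMode (-2) t) * expMode N u +
        (((N : ℂ) ^ M)⁻¹ * expMode 2 t) * expMode (-N) u := by
    intro t
    funext u
    simp only [lead, wave, one_mul, neg_one_mul, pow_zero, mul_one, Pi.one_apply]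
    ring
  have h2 : (fun t => iteratedDeriv b (fun u => lead M 0 1 N t u) s) = fun t =>
      (((N : ℂ) ^ M)⁻¹ * (Complex.I * (N : ℤ)) ^ b * expMode N s) * expMode (-2) t +
        (((N : ℂ) ^ M)⁻¹ * (Complex.I * ((-N : ℤ) : ℂ)) ^ b * expMode (-N) s) *
          expMode 2 t := by
    funext t
    rw [h1, iteratedDeriv_two_expMode]
    ring
  rw [mixedDeriv, h2, iteratedDeriv_two_expMode]
  push_cast
  ring

/-- At most `Q` derivatives in `s` cost at most `N^Q`, so the prefactor `N^{-(Q+1)}` leaves one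
power to spare. Derivatives in `θ` cost factors `2`. -/
theorem norm_mixedDeriv_lead_le {Q a b N : ℕ} (hab : a + b ≤ Q) (hN : 1 ≤ N) (θ s : ℝ) :
    ‖mixedDeriv a b (lead (Q + 1) 0 1 N) θ s‖ ≤ 2 ^ (Q + 1) * (N : ℝ)⁻¹ := by
  have hN' : (1 : ℝ) ≤ N := by exact_mod_cast hN
  have h : ((N : ℝ) ^ (Q + 1))⁻¹ * N ^ b * 2 ^ a ≤ 2 ^ Q * (N : ℝ)⁻¹ := by
    have hb : (N : ℝ) ^ b ≤ N ^ Q := pow_le_pow_right₀ hN' (by omega)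
    have ha : (2 : ℝ) ^ a ≤ 2 ^ Q := pow_le_pow_right₀ one_le_two (by omega)
    have hpos : (0 : ℝ) < N := by linarith
    calc ((N : ℝ) ^ (Q + 1))⁻¹ * N ^ b * 2 ^ a
        ≤ ((N : ℝ) ^ (Q + 1))⁻¹ * N ^ Q * 2 ^ Q := by gcongr
      _ = 2 ^ Q * (N : ℝ)⁻¹ := by
        rw [pow_succ]
        field_simp
  rw [mixedDeriv_lead]
  refine (norm_add_le _ _).trans ?_
  simp only [norm_mul, norm_inv, norm_pow, norm_expMode, Complex.norm_I, Complex.norm_natCast,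
    norm_neg, Complex.norm_ofNat, one_mul, mul_one]
  rw [pow_succ (2 : ℝ)]
  linarith

theorem sobolevNorm₂_le (Q : ℕ) : ∃ K : ℝ≥0∞, K ≠ ⊤ ∧ ∀ (f : ℝ → ℝ → ℂ) (B : ℝ),
    (∀ a b, a + b ≤ Q → ∀ θ s, ‖mixedDeriv a b f θ s‖ ≤ B) →
      sobolevNorm₂ Q f ≤ K * ENNReal.ofReal B := by
  set T : ℝ≥0∞ := ENNReal.ofReal (2 * Real.pi - 0) with hT
  set S : ℝ≥0∞ := ∑ k ∈ Finset.range (Q + 1),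
    ∑ α ∈ Finset.HasAntidiagonal.antidiagonal k, T * T with hS
  have hSfin : S ≠ ⊤ :=
    ENNReal.sum_ne_top.2 fun _ _ => ENNReal.sum_ne_top.2 fun _ _ =>
      ENNReal.mul_ne_top ENNReal.ofReal_ne_top ENNReal.ofReal_ne_top
  refine ⟨S ^ (1 / 2 : ℝ), ENNReal.rpow_ne_top_of_nonneg (by norm_num) hSfin,
    fun f B hB => ?_⟩
  have h : (∑ k ∈ Finset.range (Q + 1), ∑ α ∈ Finset.HasAntidiagonal.antidiagonal k,
      ∫⁻ θ in Set.Ioc 0 (2 * Real.pi), ∫⁻ s in Set.Ioc 0 (2 * Real.pi),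
        ‖mixedDeriv α.1 α.2 f θ s‖ₑ ^ 2) ≤ S * ENNReal.ofReal B ^ 2 := by
    rw [hS, Finset.sum_mul]
    refine Finset.sum_le_sum fun k hk => ?_
    rw [Finset.sum_mul]
    refine Finset.sum_le_sum fun α hα => ?_
    have hαQ : α.1 + α.2 ≤ Q := by
      have h1 := Finset.HasAntidiagonal.mem_antidiagonal.1 hα
      have h2 := Finset.mem_range.1 hk
      omega
    have hb : ∀ θ s, ‖mixedDeriv α.1 α.2 f θ s‖ₑ ^ 2 ≤ ENNReal.ofReal B ^ 2 := by
      intro θ s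
      gcongr
      rw [← ofReal_norm]
      exact ENNReal.ofReal_le_ofReal (hB _ _ hαQ θ s)
    calc _ ≤ ∫⁻ θ in Set.Ioc 0 (2 * Real.pi), ∫⁻ s in Set.Ioc 0 (2 * Real.pi),
          ENNReal.ofReal B ^ 2 :=
          MeasureTheory.lintegral_mono fun θ => MeasureTheory.lintegral_mono fun s => hb θ s
      _ = T * T * ENNReal.ofReal B ^ 2 := by
        simp only [MeasureTheory.lintegral_const, MeasureTheory.Measure.restrict_apply_univ,
          Real.volume_Ioc, ← hT]
        ring
  calc sobolevNorm₂ Q f ≤ (S * ENNReal.ofReal B ^ 2) ^ (1 / 2 : ℝ) :=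
        ENNReal.rpow_le_rpow h (by norm_num)
    _ = S ^ (1 / 2 : ℝ) * ENNReal.ofReal B := by
      rw [ENNReal.mul_rpow_of_nonneg _ _ (by norm_num), ← ENNReal.rpow_natCast,
        ← ENNReal.rpow_mul]
      norm_num

theorem analyticNorm_phiIC_perturb_le (x : Input) (σ : ℝ) (Q : ℕ) :
    ∃ K : ℝ≥0∞, K ≠ ⊤ ∧ ∀ N : ℕ, 1 ≤ N →
      analyticNorm σ Q ((perturb x (Q + 1) N).phiIC - x.phiIC) ≤ K * (N : ℝ≥0∞)⁻¹ := by
  obtain ⟨K, hK, h⟩ := sobolevNorm₂_le Q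
  refine ⟨ENNReal.ofReal (σ ^ 2) * (K * ENNReal.ofReal (2 ^ (Q + 1))),
    ENNReal.mul_ne_top ENNReal.ofReal_ne_top (ENNReal.mul_ne_top hK ENNReal.ofReal_ne_top),
    fun N hN => iSup_le fun m => ?_⟩
  by_cases hm : m = 2
  · subst hm
    have hlead : ((perturb x (Q + 1) N).phiIC - x.phiIC) 2 = lead (Q + 1) 0 1 N := by
      funext θ s
      simp [phiIC_perturb]
    rw [hlead, mul_assoc]
    gcongr
    refine (h _ _ fun a b hab θ s => norm_mixedDeriv_lead_le hab hN θ s).trans ?_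
    rw [ENNReal.ofReal_mul (by positivity), ENNReal.ofReal_inv_of_pos (by exact_mod_cast hN),
      ENNReal.ofReal_natCast, mul_assoc]
  · have hzero : ((perturb x (Q + 1) N).phiIC - x.phiIC) m = fun _ _ => 0 := by
      funext θ s
      simp [phiIC_perturb, hm]
    have hb := h (fun _ _ => 0) 0 fun a b _ θ s => by
      simp [mixedDeriv]
    rw [ENNReal.ofReal_zero, mul_zero, nonpos_iff_eq_zero] at hb
    rw [hzero, hb, mul_zero]
    exact zero_le

/-! ### Lower bounds in `L²`. -/

theorem lead_eq_cos (M i N : ℕ) (p : ℝ → ℂ) (θ s : ℝ) :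
    lead M i p N θ s = ((N : ℂ) ^ M)⁻¹ * (N : ℂ) ^ i * p s *
      ((2 * Real.cos (N * s - 2 * θ) : ℝ) : ℂ) := by
  have h1 : expMode (1 * N) s * expMode (-2) θ =
      Complex.exp (((N * s - 2 * θ : ℝ) : ℂ) * Complex.I) := by
    rw [expMode, expMode, ← Complex.exp_add]
    congr 1
    push_cast
    ring
  have h2 : expMode (-1 * N) s * expMode 2 θ =
      Complex.exp (-((N * s - 2 * θ : ℝ) : ℂ) * Complex.I) := by
    rw [expMode, expMode, ← Complex.exp_add]
    congr 1
    push_cast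
    ring
  rw [Complex.ofReal_mul, Complex.ofReal_cos, Complex.cos, ← h1, ← h2, lead, wave, wave]
  push_cast
  ring

theorem integral_cos_sq_frequency {N : ℕ} (hN : 1 ≤ N) (d : ℝ) :
    ∫ s in (0 : ℝ)..2 * Real.pi, Real.cos (N * s - d) ^ 2 = Real.pi := by
  have hN' : (N : ℝ) ≠ 0 := by exact_mod_cast (by omega : N ≠ 0)
  rw [intervalIntegral.integral_comp_mul_sub (fun t => Real.cos t ^ 2) hN', integral_cos_sq,
    show (N : ℝ) * (2 * Real.pi) - d = -d + N * (2 * Real.pi) by ring,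
    Real.cos_add_nat_mul_two_pi, Real.sin_add_nat_mul_two_pi, mul_zero, zero_sub, smul_eq_mul]
  field_simp
  ring

theorem lintegral_cos_sq_frequency {N : ℕ} (hN : 1 ≤ N) (d : ℝ) :
    ∫⁻ s in Set.Ioc 0 (2 * Real.pi), ENNReal.ofReal (Real.cos (N * s - d) ^ 2) =
      ENNReal.ofReal Real.pi := by
  have hint : MeasureTheory.IntegrableOn (fun s => Real.cos (N * s - d) ^ 2)
      (Set.Ioc 0 (2 * Real.pi)) := Continuous.integrableOn_Ioc (by fun_prop)
  refine (MeasureTheory.ofReal_integral_eq_lintegral_ofReal hint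
    (Filter.Eventually.of_forall fun s => sq_nonneg _)).symm.trans ?_
  rw [← intervalIntegral.integral_of_le Real.two_pi_pos.le, integral_cos_sq_frequency hN d]

/-- A bound from below for the `L²` norm of a perturbation of a plane wave. -/
theorem wave_le_lintegral_sq {N : ℕ} (hN : 1 ≤ N) {a b : ℝ} {f : ℝ → ℝ → ℂ}
    (h : ∀ θ s, a * Real.cos (N * s - 2 * θ) ^ 2 ≤ ‖f θ s‖ ^ 2 + b) (ha : 0 ≤ a) (hb : 0 ≤ b) :
    ENNReal.ofReal (2 * Real.pi ^ 2 * a) ≤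
      (∫⁻ θ in Set.Ioc 0 (2 * Real.pi), ∫⁻ s in Set.Ioc 0 (2 * Real.pi), ‖f θ s‖ₑ ^ 2) +
        ENNReal.ofReal (4 * Real.pi ^ 2 * b) := by
  have hπ := Real.pi_pos
  -- For each `θ`, integrating `cos²` over `s` gives `π` whatever the phase. Integrating then over
  -- `θ` gives `2π² a`, against the area `4π²` multiplying `b`.
  have inner : ∀ θ, ENNReal.ofReal (a * Real.pi) ≤
      (∫⁻ s in Set.Ioc 0 (2 * Real.pi), ‖f θ s‖ₑ ^ 2) + ENNReal.ofReal (b * (2 * Real.pi)) := by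
    intro θ
    calc ENNReal.ofReal (a * Real.pi)
        = ∫⁻ s in Set.Ioc 0 (2 * Real.pi),
            ENNReal.ofReal a * ENNReal.ofReal (Real.cos (N * s - 2 * θ) ^ 2) := by
          rw [MeasureTheory.lintegral_const_mul' _ _ ENNReal.ofReal_ne_top,
            lintegral_cos_sq_frequency hN, ENNReal.ofReal_mul ha]
      _ ≤ ∫⁻ s in Set.Ioc 0 (2 * Real.pi), (‖f θ s‖ₑ ^ 2 + ENNReal.ofReal b) := by
          refine MeasureTheory.lintegral_mono fun s => ?_
          rw [← ENNReal.ofReal_mul ha, ← ofReal_norm, ← ENNReal.ofReal_pow (norm_nonneg _),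
            ← ENNReal.ofReal_add (by positivity) hb]
          exact ENNReal.ofReal_le_ofReal (h θ s)
      _ = _ := by
          rw [MeasureTheory.lintegral_add_right _ measurable_const,
            MeasureTheory.lintegral_const, MeasureTheory.Measure.restrict_apply_univ,
            Real.volume_Ioc, sub_zero, ENNReal.ofReal_mul hb]
  calc ENNReal.ofReal (2 * Real.pi ^ 2 * a)
      = ∫⁻ θ in Set.Ioc 0 (2 * Real.pi), ENNReal.ofReal (a * Real.pi) := by
        rw [MeasureTheory.lintegral_const, MeasureTheory.Measure.restrict_apply_univ,
          Real.volume_Ioc, sub_zero, ← ENNReal.ofReal_mul (by positivity)]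
        congr 1
        ring
    _ ≤ ∫⁻ θ in Set.Ioc 0 (2 * Real.pi), ((∫⁻ s in Set.Ioc 0 (2 * Real.pi), ‖f θ s‖ₑ ^ 2) +
          ENNReal.ofReal (b * (2 * Real.pi))) :=
        MeasureTheory.lintegral_mono fun θ => inner θ
    _ = _ := by
        rw [MeasureTheory.lintegral_add_right _ measurable_const,
          MeasureTheory.lintegral_const, MeasureTheory.Measure.restrict_apply_univ,
          Real.volume_Ioc, sub_zero, ← ENNReal.ofReal_mul (by positivity)]
        congr 2
        ring

/-- Only the undifferentiated term of the Sobolev norm and a single order `m` are kept. Hence growth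
in `L²` at one order suffices for every `q` and `σ`. -/
theorem lintegral_sq_le_of_analyticNorm_lt {σ : ℝ} (hσ : 0 < σ) {q : ℕ} {f : RhoSeries}
    (h : analyticNorm σ q f < 1) (m : ℕ) :
    (∫⁻ θ in Set.Ioc 0 (2 * Real.pi), ∫⁻ s in Set.Ioc 0 (2 * Real.pi), ‖f m θ s‖ₑ ^ 2) ≤
      ENNReal.ofReal ((σ ^ m)⁻¹ ^ 2) := by
  have h1 : ENNReal.ofReal (σ ^ m) * sobolevNorm₂ q (f m) ≤ 1 :=
    (le_iSup (fun m => ENNReal.ofReal (σ ^ m) * sobolevNorm₂ q (f m)) m).trans h.le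
  have hpos : 0 < σ ^ m := by positivity
  have h2 : sobolevNorm₂ q (f m) ≤ ENNReal.ofReal ((σ ^ m)⁻¹) := by
    rw [ENNReal.ofReal_inv_of_pos hpos, ENNReal.le_inv_iff_mul_le, mul_comm]
    exact h1
  have h3 := ENNReal.rpow_le_rpow h2 (show (0 : ℝ) ≤ 2 by norm_num)
  rw [sobolevNorm₂, ← ENNReal.rpow_mul, show (1 / 2 : ℝ) * 2 = 1 by norm_num, ENNReal.rpow_one,
    ENNReal.rpow_two, ← ENNReal.ofReal_pow (by positivity)] at h3
  refine le_trans ?_ h3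
  refine le_trans ?_ (Finset.single_le_sum (f := fun k =>
    ∑ α ∈ Finset.HasAntidiagonal.antidiagonal k,
      ∫⁻ θ in Set.Ioc 0 (2 * Real.pi), ∫⁻ s in Set.Ioc 0 (2 * Real.pi),
        ‖mixedDeriv α.1 α.2 (f m) θ s‖ₑ ^ 2) (fun _ _ => zero_le)
    (Finset.mem_range.2 (Nat.succ_pos q)))
  simp [mixedDeriv]

/-! ### Growth of the response and failure of continuity. -/

/-- The response at order `2 q₀ + 6` to the perturbation of size `N^{-3-q₀}` is of size
`N^{1+q₀}`. -/
theorem exists_response_lower_bound {x : Input} {q₀ : ℕ} {φ : RhoSeries} {Φ : ℕ → RhoSeries}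
    (hφ : IsSolution x φ) (hΦ : ∀ N, IsSolution (perturb x (2 + q₀ + 1) N) (Φ N)) :
    ∃ c C : ℝ, 0 < c ∧ 0 ≤ C ∧ ∀ N : ℕ, 1 ≤ N → ∀ θ s,
      2 * (c * (N : ℝ) ^ (q₀ + 1)) ^ 2 * Real.cos (N * s - 2 * θ) ^ 2 ≤
        ‖(Φ N - φ) (2 * (2 + q₀) + 2) θ s‖ ^ 2 + (C * (N : ℝ) ^ q₀) ^ 2 := by
  obtain ⟨c, hc, hcamp⟩ := exists_le_amplitude x (2 + q₀)
  have hconst : Trig (waveFiltration (2 + q₀ + 1)) (2 * (2 + q₀) + 2) (2 * (2 + q₀))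
      fun _ => φ (2 * (2 + q₀) + 2) := by
    obtain ⟨-, -, h⟩ := (isSolution_iff x φ).1 hφ
    obtain ⟨g, hg, hgφ, -⟩ := h (2 * (2 + q₀))
    obtain ⟨a, ha, hag⟩ := hg.exists_coeff
    have hg' : Trig (waveFiltration (2 + q₀ + 1)) (2 * (2 + q₀)) (2 * (2 + q₀)) fun _ => g :=
      (Trig.sum _ (f := fun n _ θ s => a n () s * expMode (2 * n - (2 * (2 + q₀) : ℕ)) θ)
        fun n hn => Trig.mode n (fun _ => a n ()) (Nat.lt_succ_iff.1 (Finset.mem_range.1 hn))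
          (IsWave.const _ (ha n ()))).congr fun _ θ s => hag () θ s
    exact ((trig_phiIC x _ _ _).add _ _ hg'.raise).congr fun _ θ s => hgφ θ s
  have hrem := (trig_response_sub_lead hΦ (2 + q₀)).sub hconst
  -- With `M = q₀ + 3`, degree `2(2 + q₀) = M + 1 + q₀` means `O(N^{q₀})`, one power below the
  -- leading wave.
  obtain ⟨C, hC0, hC⟩ := (hrem.mono (show 2 * (2 + q₀) ≤ 2 + q₀ + 1 + 1 + q₀ by
    omega)).exists_norm_le
  refine ⟨c, C, hc, hC0, fun N hN θ s => ?_⟩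
  have hN' : (0 : ℝ) < N := by exact_mod_cast hN
  set L := lead (2 + q₀ + 1) (2 * (2 + q₀)) (fun u => (amplitude x.axis (2 + q₀) u : ℂ)) N θ s
    with hL
  set F := (Φ N - φ) (2 * (2 + q₀) + 2) θ s with hF
  have hR : ‖F - L‖ ≤ C * (N : ℝ) ^ q₀ := by
    refine le_trans (le_of_eq (congrArg norm ?_)) (hC N hN θ s)
    simp only [hF, hL, Pi.sub_apply]
    ring
  have hLnorm : ‖L‖ = (N : ℝ) ^ (q₀ + 1) * amplitude x.axis (2 + q₀) s *
      (2 * |Real.cos (N * s - 2 * θ)|) := by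
    rw [hL, lead_eq_cos, norm_mul, norm_mul, norm_mul, norm_inv, norm_pow, norm_pow,
      Complex.norm_natCast, Complex.norm_real, Complex.norm_real, Real.norm_eq_abs,
      Real.norm_eq_abs, abs_of_pos (amplitude_pos x _ s), abs_mul, abs_two]
    congr 2
    rw [inv_mul_eq_iff_eq_mul₀ (by positivity), ← pow_add]
    congr 1
    ring
  have hLlow : 2 * (c * (N : ℝ) ^ (q₀ + 1)) * |Real.cos (N * s - 2 * θ)| ≤ ‖L‖ := by
    rw [hLnorm]
    have := mul_le_mul_of_nonneg_right (hcamp s) (show 0 ≤ (N : ℝ) ^ (q₀ + 1) *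
      (2 * |Real.cos (N * s - 2 * θ)|) by positivity)
    linarith
  have htri : ‖L‖ ≤ ‖F‖ + C * (N : ℝ) ^ q₀ := by
    have := norm_sub_norm_le L F
    rw [norm_sub_rev] at this
    linarith
  have hsq := pow_le_pow_left₀ (by positivity) (hLlow.trans htri) 2
  rw [mul_pow, sq_abs] at hsq
  -- Uses `(u + v)² ≤ 2u² + 2v²`; the factor `4` from squaring `2 cos` thus becomes the `2` of the
  -- statement.
  nlinarith [sq_nonneg (‖F‖ - C * (N : ℝ) ^ q₀)]

/-- The class `𝒳` only has to contain the perturbations of `x`, so general and physical inputs are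
treated at once. If the response stayed below `ε = 1`, its `L²` norm at order `2q₀ + 6` would be
bounded in `N`, against its growth like `N^{q₀+1}`. -/
theorem not_solutionContinuousAt {𝒳 : Set Input} {x : Input}
    (h𝒳 : ∀ M N, perturb x M N ∈ 𝒳) (q₀ q : ℕ) (σ₀ : ℝ) {σ : ℝ} (hσ : 0 < σ) :
    ¬ SolutionContinuousAt 𝒳 q₀ q σ₀ σ x := by
  intro hcont
  obtain ⟨δ, hδ, h⟩ := hcont 1 one_pos
  obtain ⟨K, hK, hsmall⟩ := analyticNorm_phiIC_perturb_le x σ₀ (2 + q₀)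
  have hΦ := fun N => isSolution_solution (perturb x (2 + q₀ + 1) N)
  obtain ⟨c, C, hc, hC, hlow⟩ := exists_response_lower_bound (isSolution_solution x) hΦ
  have htend : Filter.Tendsto (fun N : ℕ => K * (N : ℝ≥0∞)⁻¹) Filter.atTop (nhds 0) := by
    simpa using ENNReal.Tendsto.const_mul ENNReal.tendsto_inv_nat_nhds_zero (Or.inr hK)
  set B : ℝ := (σ ^ (2 * (2 + q₀) + 2))⁻¹ ^ 2 with hB
  have hB0 : 0 ≤ B := by positivity
  have hbig : Filter.Tendsto (fun N : ℕ => (N : ℝ) ^ 2 * (4 * Real.pi ^ 2 * c ^ 2))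
      Filter.atTop Filter.atTop :=
    ((Filter.tendsto_pow_atTop two_ne_zero).comp tendsto_natCast_atTop_atTop).atTop_mul_const
      (by have := Real.pi_pos; positivity)
  obtain ⟨N, hNδ, hNbig, hN⟩ := ((htend.eventually_lt_const hδ).and
    ((hbig.eventually_gt_atTop (B + 4 * Real.pi ^ 2 * C ^ 2)).and
      (Filter.eventually_ge_atTop 1))).exists
  have hnorm := h (perturb x (2 + q₀ + 1) N) (h𝒳 _ _)
    (by
      change cNorm _ (x.axis - x.axis) < δ
      rwa [sub_self, cNorm_zero])
    (by
      change sobolevNorm _ (x.field - x.field) < δ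
      rwa [sub_self, sobolevNorm_zero])
    ((hsmall N hN).trans_lt hNδ) _ _ (isSolution_solution x) (hΦ N)
  have hI := lintegral_sq_le_of_analyticNorm_lt hσ hnorm (2 * (2 + q₀) + 2)
  have hJ := (wave_le_lintegral_sq hN (hlow N hN) (by positivity) (by positivity)).trans
    (add_le_add_left hI _)
  rw [← hB, ← ENNReal.ofReal_add hB0 (by positivity),
    ENNReal.ofReal_le_ofReal_iff (by positivity)] at hJ
  have hN' : (1 : ℝ) ≤ (N : ℝ) ^ q₀ := one_le_pow₀ (by exact_mod_cast hN)
  have hP : 1 ≤ ((N : ℝ) ^ q₀) ^ 2 := one_le_pow₀ hN'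
  -- Factoring out `N^{2q₀}` reduces the contradiction to `N² · 4π²c² > B + 4π²C²`, which was built
  -- into the choice of `N`.
  have hscale : B + 4 * Real.pi ^ 2 * (C * (N : ℝ) ^ q₀) ^ 2 ≤
      ((N : ℝ) ^ q₀) ^ 2 * (B + 4 * Real.pi ^ 2 * C ^ 2) := by
    nlinarith [mul_le_mul_of_nonneg_right hP hB0]
  have hlt := mul_lt_mul_of_pos_left hNbig (show 0 < ((N : ℝ) ^ q₀) ^ 2 by linarith)
  have hsplit : 2 * Real.pi ^ 2 * (2 * (c * (N : ℝ) ^ (q₀ + 1)) ^ 2) =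
      ((N : ℝ) ^ q₀) ^ 2 * ((N : ℝ) ^ 2 * (4 * Real.pi ^ 2 * c ^ 2)) := by ring
  linarith

end NearAxis

end

theorem theorem1 :
    (∀ x : NearAxis.Input, ∃! φ : NearAxis.RhoSeries, NearAxis.IsSolution x φ) ∧
    ∀ (q₀ q : ℕ) (σ₀ σ : ℝ), 2 ≤ q → 0 < σ₀ → 0 < σ →
      (∀ x : NearAxis.Input,
        ¬ NearAxis.SolutionContinuousAt Set.univ q₀ q σ₀ σ x) ∧
      (∀ x ∈ NearAxis.physicalInputs,
        ¬ NearAxis.SolutionContinuousAt NearAxis.physicalInputs q₀ q σ₀ σ x) :=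
  ⟨NearAxis.existsUnique_isSolution, fun q₀ q σ₀ _ _ _ hσ =>
    ⟨fun _ => NearAxis.not_solutionContinuousAt (fun _ _ => Set.mem_univ _) q₀ q σ₀ hσ,
      fun _ hx => NearAxis.not_solutionContinuousAt
        (NearAxis.perturb_mem_physicalInputs hx) q₀ q σ₀ hσ⟩⟩
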